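/- Let $M,L,N\ge 1$ be integers, put $c=\frac{ML}{N}$, and let $R$ be an $M\times M$ Hermitian positive definite complex matrix. Let $\mathbb{C}^+=\{z\in\mathbb{C}:\mathrm{Im}\,z>0\}$. For $z\in\mathbb{C}^+$, let $t(z)$ be the unique solution of $$t(z)=\frac1M\mathrm{Tr}\Big(R\,T(z)\Big),\qquad T(z)=\Big(-zI_M-\frac{z\,c\,t(z)}{1-z\,c^2\,t(z)^2}R\Big)^{-1},$$ such that $t(z)\in\mathbb{C}^+$ and $z\,t(z)\in\mathbb{C}^+$, and let $\nu$ be the unique finite positive measure carried by $[0,\infty)$ with Stieltjes transform $$\int\frac{d\nu(\lambda)}{\lambda-z}=\frac1M\mathrm{Tr}\,T(z),\qquad z\in\mathbb{C}^+ .$$ Assume $c\le 1$. Then $t(z)$ and $\nu$ are well defined, $\nu$ is a probability measure, and it is absolutely continuous with respect to the Lebesgue measure, with a density $g$ that is continuous on $(0,\infty)$ (and vanishes on $(-\infty,0)$). Moreover $g(x)\to+\infty$ as $x\to0^+$, and more precisely, as $x\to 0^+$: - if $c<1$, then $\displaystyle g(x)\sim\frac1\pi\,\frac{1}{\sqrt{c(1-c)}}\,\frac1M\mathrm{Tr}(R^{-1})\,\frac{1}{\sqrt{x}}$;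 - if $c=1$, then $\displaystyle g(x)\sim\frac{\sqrt3}{2\pi}\Big(\frac1M\mathrm{Tr}(R^{-1})\Big)^{2/3}\frac{1}{x^{2/3}}$. Here $u(x)\sim v(x)$ means $u(x)/v(x)\to1$. -/

import Mathlib

open MeasureTheory Filter Topology Set
open scoped ComplexOrder

noncomputable section

/-- The matrix `T = (-z I - (z c t / (1 - z c² t²)) R)⁻¹` attached to complex numbers `z` and `t`. -/
def resolventMatrix {M : ℕ} (c : ℝ) (R : Matrix (Fin M) (Fin M) ℂ) (z t : ℂ) :
    Matrix (Fin M) (Fin M) ℂ :=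
  (-(z • (1 : Matrix (Fin M) (Fin M) ℂ)) - ((z * c * t) / (1 - z * c ^ 2 * t ^ 2)) • R)⁻¹

/-- `t` solves the canonical equation `t = (1/M) Tr (R T)` at the point `z`,
with both `t` and `z t` in the open upper half-plane. -/
structure IsCanonicalSolution {M : ℕ} (c : ℝ) (R : Matrix (Fin M) (Fin M) ℂ) (z t : ℂ) :
    Prop where
  im_pos : 0 < t.im
  mul_im_pos : 0 < (z * t).im
  eq : t = (1 / (M : ℂ)) * (R * resolventMatrix c R z t).trace

/-- The function `t(z)`: the solution of the canonical equation at `z`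
(for `z` in the open upper half-plane). -/
def canonicalT {M : ℕ} (c : ℝ) (R : Matrix (Fin M) (Fin M) ℂ) (z : ℂ) : ℂ :=
  Classical.epsilon (IsCanonicalSolution c R z)

/-- The matrix-valued function `T(z)`. -/
def matrixT {M : ℕ} (c : ℝ) (R : Matrix (Fin M) (Fin M) ℂ) (z : ℂ) :
    Matrix (Fin M) (Fin M) ℂ :=
  resolventMatrix c R z (canonicalT c R z)

/-- `ν` is a finite positive measure carried by `[0, ∞)` whose Stieltjes transform on the open
upper half-plane is `z ↦ (1/M) Tr T(z)`. -/
structure HasCanonicalStieltjes {M : ℕ} (c : ℝ) (R : Matrix (Fin M) (Fin M) ℂ)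
    (ν : Measure ℝ) : Prop where
  finite : IsFiniteMeasure ν
  carried : ν (Iio 0) = 0
  stieltjes : ∀ z : ℂ, 0 < z.im →
    ∫ x : ℝ, ((x : ℂ) - z)⁻¹ ∂ν = (1 / (M : ℂ)) * (matrixT c R z).trace

/-- The deterministic equivalent: the measure with Stieltjes transform `(1/M) Tr T(z)`. -/
def deterministicEquivalent {M : ℕ} (c : ℝ) (R : Matrix (Fin M) (Fin M) ℂ) : Measure ℝ :=
  Classical.epsilon (HasCanonicalStieltjes c R)

/-- `g` is a nonnegative density on `(0, ∞)` of `ν` with respect to Lebesgue measure, continuous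
on `(0, ∞)`. Its values on `(0, ∞)` are determined by `ν`. -/
structure IsContinuousDensity (ν : Measure ℝ) (g : ℝ → ℝ) : Prop where
  continuousOn : ContinuousOn g (Ioi 0)
  nonneg : ∀ x ∈ Ioi (0 : ℝ), 0 ≤ g x
  eq_withDensity : ν = (volume.restrict (Ioi 0)).withDensity (fun x => ENNReal.ofReal (g x))

/-- The real number `(1/M) Tr R⁻¹` (the trace is real when `R` is Hermitian). -/
def normalizedTraceInv {M : ℕ} (R : Matrix (Fin M) (Fin M) ℂ) : ℝ :=
  (1 / (M : ℝ)) * (R⁻¹).trace.re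

end

/-!
In an eigenbasis of `R`, with eigenvalues `r₁, …, r_M`, put `q = z t(z)` and
`p = c q - z / (c q)`. Then `T(z)` has the eigenvalues `p / (z (rᵢ - p))`, the trace condition on
`t(z)` reads `q = (1/M) ∑ᵢ rᵢ p / (rᵢ - p)`, and the definition of `p` becomes
`z = φ(p)` with the explicit rational function `φ(p) = -c q (p - c q)`. So the canonical equation
is solved by inverting `φ`.

The conditions `Im p > 0`, `Im φ(p) > 0`, `Im (-φ(p) / p) > 0` cut out an open set on which `φ` is
injective: a Cauchy–Schwarz estimate, in which the three signs enter as energy inequalities, keeps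
its divided differences away from `0`. The same estimates prevent `p` from escaping to the boundary
while `φ(p)` stays in the upper half-plane, so the image is open and relatively closed, hence it is
the whole half-plane. As `z` tends to a real point, the cluster set of `φ⁻¹` is connected and
contained in a finite fibre of `φ`, so `φ⁻¹` extends continuously to the real line, and with it
`m(z) = (1/M) Tr T(z)`, except at `0`.

Near `0`, `φ(p) ~ -c (1 - c) p²` if `c < 1` and `φ(p) ~ (1/M) Tr(R⁻¹) p³` if `c = 1`, while
`z m(z) ~ (1/M) Tr(R⁻¹) p`. This gives the limits of `m² z` and `m³ z²`, respectively, and the signs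
of `Im m` and `Re m` on the positive axis select the square and cube root. In both cases
`m(z) = O(|z| ^ (-2/3))`, so that Cauchy's formula applies up to the boundary and exhibits `m` as
the Stieltjes transform of `Im m(x) / π dx`.
-/

noncomputable section

open Bornology
open UpperHalfPlane (upperHalfPlaneSet isOpen_upperHalfPlaneSet)
open scoped BigOperators ComplexConjugate

namespace CanonicalEquation

lemma ofReal_ne_of_im_pos {p : ℂ} (hp : 0 < p.im) (x : ℝ) : (x : ℂ) ≠ p := by
  rintro rfl
  simp at hp

lemma ne_zero_of_im_pos {p : ℂ} (hp : 0 < p.im) : p ≠ 0 := by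
  rintro rfl
  simp at hp

section Transfer

variable {ι : Type*} [Fintype ι] {r : ι → ℝ} {p p' : ℂ}

/-- The average of `rᵢ / (rᵢ - p)`. When `p = canonicalInv c r z`, this is `1 + (z/M) Tr T(z)`. -/
def ratioMean (r : ι → ℝ) (p : ℂ) : ℂ := 𝔼 i, (r i : ℂ) / (r i - p)

/-- The average of `rᵢ p / (rᵢ - p)`. When `p = canonicalInv c r z`, this is `z t(z)`. -/
def transfer (r : ι → ℝ) (p : ℂ) : ℂ := p * ratioMean r p

/-- The divided difference of `transfer r` between `p` and `p'`; its diagonal is the derivative. -/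
def transferSlope (r : ι → ℝ) (p p' : ℂ) : ℂ := 𝔼 i, (r i : ℂ) ^ 2 / ((r i - p) * (r i - p'))

/-- The factor by which `transfer r` multiplies imaginary parts. By Cauchy–Schwarz it also controls
`transferSlope`, which is how injectivity of `canonicalMap` is obtained. -/
def transferEnergy (r : ι → ℝ) (p : ℂ) : ℝ := 𝔼 i, (r i / ‖(r i : ℂ) - p‖) ^ 2

lemma transfer_eq_expect (r : ι → ℝ) (p : ℂ) :
    transfer r p = 𝔼 i, (r i : ℂ) * p / (r i - p) := by
  rw [transfer, ratioMean, Finset.mul_expect]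
  exact Finset.expect_congr rfl fun i _ => by ring

lemma im_transfer (r : ι → ℝ) (p : ℂ) : (transfer r p).im = transferEnergy r p * p.im := by
  rw [transfer_eq_expect, Complex.im_expect, transferEnergy, Finset.expect_mul]
  refine Finset.expect_congr rfl fun i _ => ?_
  rw [Complex.div_im, div_pow, Complex.sq_norm]
  simp only [Complex.im_ofReal_mul, Complex.re_ofReal_mul, Complex.sub_re, Complex.sub_im,
    Complex.ofReal_re, Complex.ofReal_im]
  ring

lemma im_ratioMean (r : ι → ℝ) (p : ℂ) :
    (ratioMean r p).im = (𝔼 i, r i / ‖(r i : ℂ) - p‖ ^ 2) * p.im := by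
  rw [ratioMean, Complex.im_expect, Finset.expect_mul]
  refine Finset.expect_congr rfl fun i _ => ?_
  rw [Complex.div_im, Complex.sq_norm]
  simp only [Complex.sub_re, Complex.sub_im, Complex.ofReal_re, Complex.ofReal_im]
  ring

lemma transferEnergy_nonneg (r : ι → ℝ) (p : ℂ) : 0 ≤ transferEnergy r p :=
  Finset.expect_nonneg fun _ _ => sq_nonneg _

lemma norm_transferSlope_sq_le (r : ι → ℝ) (p p' : ℂ) :
    ‖transferSlope r p p'‖ ^ 2 ≤ transferEnergy r p * transferEnergy r p' := by
  refine (pow_le_pow_left₀ (norm_nonneg _) (RCLike.norm_expect_le (K := ℂ)) 2).trans ?_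
  simpa only [transferEnergy, norm_div, norm_mul, norm_pow, Complex.norm_real, Real.norm_eq_abs,
    sq_abs, div_mul_div_comm, ← sq] using
    Finset.expect_mul_sq_le_sq_mul_sq Finset.univ (fun i => r i / ‖(r i : ℂ) - p‖)
      fun i => r i / ‖(r i : ℂ) - p'‖

lemma norm_ratioMean_sq_le [Nonempty ι] (r : ι → ℝ) (p : ℂ) :
    ‖ratioMean r p‖ ^ 2 ≤ transferEnergy r p := by
  refine (pow_le_pow_left₀ (norm_nonneg _) (RCLike.norm_expect_le (K := ℂ)) 2).trans ?_
  simpa only [transferEnergy, norm_div, Complex.norm_real, Real.norm_eq_abs, sq_abs, div_pow,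
    mul_one, one_pow, Fintype.expect_const] using
    Finset.expect_mul_sq_le_sq_mul_sq Finset.univ (fun i => ‖(r i : ℂ) / (r i - p)‖) fun _ => 1

lemma sq_le_card_mul_transferEnergy (r : ι → ℝ) (p : ℂ) (i : ι) :
    (r i / ‖(r i : ℂ) - p‖) ^ 2 ≤ Fintype.card ι * transferEnergy r p := by
  rw [transferEnergy, Fintype.card_mul_expect]
  exact Finset.single_le_sum (f := fun i => (r i / ‖(r i : ℂ) - p‖) ^ 2)
    (fun _ _ => sq_nonneg _) (Finset.mem_univ i)

lemma transfer_sub (hp : ∀ i, (r i : ℂ) ≠ p) (hp' : ∀ i, (r i : ℂ) ≠ p') :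
    transfer r p - transfer r p' = (p - p') * transferSlope r p p' := by
  rw [transfer_eq_expect, transfer_eq_expect, transferSlope, ← Finset.expect_sub_distrib,
    Finset.mul_expect]
  refine Finset.expect_congr rfl fun i _ => ?_
  have h := sub_ne_zero.2 (hp i)
  have h' := sub_ne_zero.2 (hp' i)
  field_simp
  ring

lemma hasStrictDerivAt_transfer (hp : ∀ i, (r i : ℂ) ≠ p) :
    HasStrictDerivAt (transfer r) (transferSlope r p p) p := by
  have hterm : ∀ i, HasStrictDerivAt (fun w : ℂ => (r i : ℂ) * w / (r i - w))
      ((r i : ℂ) ^ 2 / ((r i - p) * (r i - p))) p := fun i => by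
    refine (((hasStrictDerivAt_id p).const_mul (r i : ℂ)).div
      ((hasStrictDerivAt_id p).const_sub (r i : ℂ)) (sub_ne_zero.2 (hp i))).congr_deriv ?_
    simp only [id]
    ring
  rw [funext (transfer_eq_expect r), transferSlope]
  simp only [Fintype.expect_eq_sum_div_card]
  exact (HasStrictDerivAt.fun_sum fun i _ => hterm i).div_const _

lemma tendsto_ratioMean_cobounded (r : ι → ℝ) :
    Tendsto (ratioMean r) (cobounded ℂ) (𝓝 0) := by
  have hterm : ∀ i, Tendsto (fun p : ℂ => (r i : ℂ) / (r i - p)) (cobounded ℂ) (𝓝 0) := fun i => by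
    simpa only [div_eq_mul_inv, mul_zero, Function.comp_def] using
      (tendsto_inv₀_cobounded.comp (tendsto_const_sub_cobounded (r i : ℂ))).const_mul (r i : ℂ)
  unfold ratioMean
  simp only [Fintype.expect_eq_sum_div_card]
  simpa using (tendsto_finsetSum Finset.univ fun i _ => hterm i).div_const (Fintype.card ι : ℂ)

lemma tendsto_transfer_cobounded (r : ι → ℝ) :
    Tendsto (transfer r) (cobounded ℂ) (𝓝 (-𝔼 i, (r i : ℂ))) := by
  have hterm : ∀ i, Tendsto (fun p : ℂ => (r i : ℂ) * p / (r i - p)) (cobounded ℂ)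
      (𝓝 (-(r i : ℂ))) := fun i => by
    have h := ((tendsto_inv₀_cobounded.comp
      (tendsto_const_sub_cobounded (r i : ℂ))).const_mul ((r i : ℂ) ^ 2)).const_add (-r i : ℂ)
    rw [mul_zero, add_zero] at h
    refine h.congr' ?_
    filter_upwards [eventually_ne_cobounded (r i : ℂ)] with p hp
    have := sub_ne_zero.2 hp.symm
    simp only [Function.comp_apply]
    field_simp
    ring
  rw [funext (transfer_eq_expect r)]
  simp only [Fintype.expect_eq_sum_div_card, ← neg_div, ← Finset.sum_neg_distrib]
  exact (tendsto_finsetSum _ fun i _ => hterm i).div_const _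

variable [Nonempty ι]

lemma re_ratioMean_pos (hr : ∀ i, 0 < r i) (hp : p.re ≤ 0) : 0 < (ratioMean r p).re := by
  rw [ratioMean, Complex.re_expect]
  refine Finset.expect_pos (fun i _ => ?_) Finset.univ_nonempty
  have hre : 0 < r i - p.re := by linarith [hr i]
  have hnorm : 0 < Complex.normSq (r i - p) :=
    Complex.normSq_pos.2 fun h => hre.ne' (by simpa using congrArg Complex.re h)
  rw [Complex.div_re]
  simp only [Complex.sub_re, Complex.sub_im, Complex.ofReal_re, Complex.ofReal_im, zero_mul,
    zero_div, add_zero]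
  exact div_pos (mul_pos (hr i) hre) hnorm

lemma im_ratioMean_pos (hr : ∀ i, 0 < r i) (hp : 0 < p.im) : 0 < (ratioMean r p).im := by
  rw [im_ratioMean]
  refine mul_pos (Finset.expect_pos (fun i _ => div_pos (hr i) (pow_pos ?_ 2))
    Finset.univ_nonempty) hp
  exact norm_pos_iff.2 (sub_ne_zero.2 (ofReal_ne_of_im_pos hp _))

lemma transferEnergy_pos (hr : ∀ i, 0 < r i) (hp : ∀ i, (r i : ℂ) ≠ p) :
    0 < transferEnergy r p :=
  Finset.expect_pos (fun i _ => pow_pos (div_pos (hr i)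
    (norm_pos_iff.2 (sub_ne_zero.2 (hp i)))) 2) Finset.univ_nonempty

end Transfer

section CanonicalMap

variable {ι : Type*} [Fintype ι] {r : ι → ℝ} {c : ℝ} {p p' z : ℂ}

/-- The rational map inverting the canonical equation: with `p = c z t - 1 / (c t)` and
`transfer r p = z t`, the canonical equation becomes `canonicalMap c r p = z`. -/
def canonicalMap (c : ℝ) (r : ι → ℝ) (p : ℂ) : ℂ :=
  -c * transfer r p * (p - c * transfer r p)

/-- The domain on which `canonicalMap c r` is a bijection onto the upper half-plane. -/
def canonicalDomain (c : ℝ) (r : ι → ℝ) : Set ℂ :=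
  {p | 0 < p.im ∧ 0 < (canonicalMap c r p).im ∧ 0 < (-canonicalMap c r p / p).im}

/-- The divided difference of `canonicalMap c r` between `p` and `p'`; its diagonal is the
derivative. -/
def canonicalMapSlope (c : ℝ) (r : ι → ℝ) (p p' : ℂ) : ℂ :=
  -c * transfer r p' + c * transferSlope r p p' * (c * (transfer r p + transfer r p') - p)

lemma canonicalMap_eq (c : ℝ) (r : ι → ℝ) (p : ℂ) :
    canonicalMap c r p = -c * p ^ 2 * ratioMean r p * (1 - c * ratioMean r p) := by
  rw [canonicalMap, transfer]
  ring

lemma canonicalMap_zero (c : ℝ) (r : ι → ℝ) : canonicalMap c r 0 = 0 := by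
  simp [canonicalMap_eq]

lemma ne_of_mem_canonicalDomain (hp : p ∈ canonicalDomain c r) (i : ι) : (r i : ℂ) ≠ p :=
  ofReal_ne_of_im_pos hp.1 _

lemma transfer_ne_zero (hz : z ≠ 0) (h : canonicalMap c r p = z) : transfer r p ≠ 0 := by
  rintro h0
  exact hz (by rw [← h, canonicalMap, h0, mul_zero, zero_mul])

lemma eq_sub_inv_of_canonicalMap_eq (hc : c ≠ 0) (hz : z ≠ 0) (h : canonicalMap c r p = z) :
    p = c * transfer r p - (c * (transfer r p / z))⁻¹ := by
  have hq := transfer_ne_zero hz h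
  have hc' : (c : ℂ) ≠ 0 := Complex.ofReal_ne_zero.2 hc
  rw [canonicalMap] at h
  field_simp
  rw [← h]
  ring

lemma inv_neg_div_of_canonicalMap_eq (hc : c ≠ 0) (hz : z ≠ 0) (h : canonicalMap c r p = z) :
    (-z / p)⁻¹ = (c * transfer r p)⁻¹ - c * (transfer r p / z) := by
  have hq := transfer_ne_zero hz h
  have hc' : (c : ℂ) ≠ 0 := Complex.ofReal_ne_zero.2 hc
  rw [canonicalMap] at h
  rw [inv_div]
  field_simp
  rw [← h]
  ring

lemma im_eq_of_canonicalMap_eq (hc : c ≠ 0) (hz : z ≠ 0) (h : canonicalMap c r p = z) :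
    p.im = c * (transfer r p).im +
      ‖z‖ ^ 2 / (c * ‖transfer r p‖ ^ 2) * (transfer r p / z).im := by
  have hq := norm_ne_zero_iff.2 (transfer_ne_zero hz h)
  have him := congrArg Complex.im (eq_sub_inv_of_canonicalMap_eq hc hz h)
  rw [Complex.sub_im, Complex.inv_im, Complex.im_ofReal_mul, Complex.im_ofReal_mul,
    ← Complex.sq_norm, norm_mul, norm_div, Complex.norm_real, mul_pow, div_pow, Real.norm_eq_abs,
    sq_abs] at him
  rw [him]
  field_simp
  ring

lemma im_neg_div_of_canonicalMap_eq (hc : c ≠ 0) (hz : z ≠ 0) (hp : p ≠ 0)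
    (h : canonicalMap c r p = z) :
    (-z / p).im = ‖z‖ ^ 2 / ‖p‖ ^ 2 *
      (c * (transfer r p / z).im + (transfer r p).im / (c * ‖transfer r p‖ ^ 2)) := by
  have hq := norm_ne_zero_iff.2 (transfer_ne_zero hz h)
  have hz' := norm_ne_zero_iff.2 hz
  have hp' := norm_ne_zero_iff.2 hp
  have him := congrArg Complex.im (inv_neg_div_of_canonicalMap_eq hc hz h)
  rw [Complex.sub_im, Complex.inv_im, Complex.inv_im, Complex.im_ofReal_mul, Complex.im_ofReal_mul,
    ← Complex.sq_norm, ← Complex.sq_norm, norm_mul, norm_div, norm_neg, Complex.norm_real, mul_pow,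
    div_pow, Real.norm_eq_abs, sq_abs] at him
  field_simp at him ⊢
  linear_combination -him

lemma im_transfer_div (hp : ∀ i, (r i : ℂ) ≠ p) (hp0 : p ≠ 0) (hz : z ≠ 0) :
    (transfer r p / z).im = ‖p‖ ^ 2 / ‖z‖ ^ 2 *
      (z.im * (𝔼 i, r i / ‖(r i : ℂ) - p‖ ^ 2) + (-z / p).im * transferEnergy r p) := by
  have hp' := norm_ne_zero_iff.2 hp0
  have hz' := norm_ne_zero_iff.2 hz
  rw [transfer_eq_expect, Finset.expect_div, Complex.im_expect, transferEnergy,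
    Finset.mul_expect, Finset.mul_expect, ← Finset.expect_add_distrib, Finset.mul_expect]
  refine Finset.expect_congr rfl fun i _ => ?_
  have hri := sub_ne_zero.2 (hp i)
  have hri' := norm_ne_zero_iff.2 hri
  have hden : z * (r i - p) / p = -z - -z / p * r i := by field_simp; ring
  have hterm : (r i : ℂ) * p / (r i - p) / z = r i / (-z - -z / p * r i) := by
    rw [← hden]
    field_simp
  have hnorm : ‖-z - -z / p * r i‖ = ‖z‖ * ‖(r i : ℂ) - p‖ / ‖p‖ := by
    rw [← hden, norm_div, norm_mul]
  rw [hterm, Complex.div_im, ← Complex.sq_norm, hnorm]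
  simp only [Complex.ofReal_re, Complex.ofReal_im, Complex.sub_im, Complex.neg_im,
    Complex.im_mul_ofReal]
  field_simp
  ring

lemma mul_transferEnergy_lt_im_transfer_div [Nonempty ι] (hr : ∀ i, 0 < r i)
    (hp : ∀ i, (r i : ℂ) ≠ p) (hp0 : p ≠ 0) (hz : 0 < z.im) :
    ‖p‖ ^ 2 / ‖z‖ ^ 2 * ((-z / p).im * transferEnergy r p) < (transfer r p / z).im := by
  have hz0 := ne_zero_of_im_pos hz
  have hmean : 0 < 𝔼 i, r i / ‖(r i : ℂ) - p‖ ^ 2 := Finset.expect_pos (fun i _ =>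
    div_pos (hr i) (pow_pos (norm_pos_iff.2 (sub_ne_zero.2 (hp i))) 2)) Finset.univ_nonempty
  rw [im_transfer_div hp hp0 hz0]
  gcongr
  exact lt_add_of_pos_left _ (mul_pos hz hmean)

lemma im_transfer_div_pos [Nonempty ι] (hr : ∀ i, 0 < r i) (hp : ∀ i, (r i : ℂ) ≠ p) (hp0 : p ≠ 0)
    (hz : 0 < z.im) (hs : 0 ≤ (-z / p).im) : 0 < (transfer r p / z).im :=
  (mul_nonneg (by positivity) (mul_nonneg hs (transferEnergy_nonneg r p))).trans_lt
    (mul_transferEnergy_lt_im_transfer_div hr hp hp0 hz)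

lemma mem_canonicalDomain_of_im_pos (hc : 0 < c) (hz : 0 < z.im) (h : canonicalMap c r p = z)
    (ht : 0 < (transfer r p / z).im) (hq : 0 ≤ (transfer r p).im) : p ∈ canonicalDomain c r := by
  have hz0 := ne_zero_of_im_pos hz
  have hq0 := transfer_ne_zero hz0 h
  have hp : 0 < p.im := by
    rw [im_eq_of_canonicalMap_eq hc.ne' hz0 h]
    positivity
  have hp0 := ne_zero_of_im_pos hp
  refine ⟨hp, h.symm ▸ hz, ?_⟩
  rw [h, im_neg_div_of_canonicalMap_eq hc.ne' hz0 hp0 h]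
  positivity

lemma transferEnergy_mul_lt_one [Nonempty ι] (hr : ∀ i, 0 < r i) (hc : 0 < c)
    (hp : p ∈ canonicalDomain c r) (h : canonicalMap c r p = z) :
    transferEnergy r p * (c + ‖z‖ / (c * ‖transfer r p‖ ^ 2)) < 1 := by
  obtain ⟨hp_im, hz, hs⟩ := hp
  rw [h] at hz hs
  have hp0 := ne_zero_of_im_pos hp_im
  have hz0 := ne_zero_of_im_pos hz
  have hri i := ofReal_ne_of_im_pos hp_im (r i)
  have hX := im_transfer_div_pos hr hri hp0 hz hs.le
  have hY : 0 < (transfer r p).im := by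
    rw [im_transfer]
    exact mul_pos (transferEnergy_pos hr hri) hp_im
  have hYeq := im_transfer r p
  rw [im_eq_of_canonicalMap_eq hc.ne' hz0 h] at hYeq
  have hXgt : transferEnergy r p * (c * (transfer r p / z).im +
      (transfer r p).im / (c * ‖transfer r p‖ ^ 2)) < (transfer r p / z).im := by
    refine Eq.trans_lt ?_ (mul_transferEnergy_lt_im_transfer_div hr hri hp0 hz)
    rw [im_neg_div_of_canonicalMap_eq hc.ne' hz0 hp0 h]
    field_simp
  have hsum : 0 < ‖z‖ * (transfer r p / z).im + (transfer r p).im := by positivity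
  refine lt_of_mul_lt_mul_right ?_ hsum.le
  linear_combination ‖z‖ * hXgt - hYeq

lemma transferEnergy_lt_inv [Nonempty ι] (hr : ∀ i, 0 < r i) (hc : 0 < c)
    (hp : p ∈ canonicalDomain c r) : transferEnergy r p < c⁻¹ := by
  rw [lt_inv_comm₀ (transferEnergy_pos hr (ne_of_mem_canonicalDomain hp)) hc, ← one_div,
    lt_div_iff₀' (transferEnergy_pos hr (ne_of_mem_canonicalDomain hp))]
  refine lt_of_le_of_lt ?_ (transferEnergy_mul_lt_one hr hc hp rfl)
  gcongr
  · exact transferEnergy_nonneg r p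
  · exact le_add_of_nonneg_right (by positivity)

lemma norm_transferSlope_mul_lt_one [Nonempty ι] (hr : ∀ i, 0 < r i) (hc : 0 < c)
    (hp : p ∈ canonicalDomain c r) (hp' : p' ∈ canonicalDomain c r)
    (h : canonicalMap c r p = z) (h' : canonicalMap c r p' = z) :
    ‖transferSlope r p p'‖ * (c + ‖z‖ / (c * (‖transfer r p‖ * ‖transfer r p'‖))) < 1 := by
  have hz0 : z ≠ 0 := h ▸ ne_zero_of_im_pos hp.2.1
  have ha := norm_pos_iff.2 (transfer_ne_zero hz0 h)
  have hb := norm_pos_iff.2 (transfer_ne_zero hz0 h')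
  have hlt := transferEnergy_mul_lt_one hr hc hp h
  have hlt' := transferEnergy_mul_lt_one hr hc hp' h'
  have hslope := norm_transferSlope_sq_le r p p'
  have hκ := transferEnergy_nonneg r p
  have hκ' := transferEnergy_nonneg r p'
  set a := ‖transfer r p‖
  set b := ‖transfer r p'‖
  have hcauchy : (c + ‖z‖ / (c * (a * b))) ^ 2 ≤
      (c + ‖z‖ / (c * a ^ 2)) * (c + ‖z‖ / (c * b ^ 2)) := by
    have : (c + ‖z‖ / (c * a ^ 2)) * (c + ‖z‖ / (c * b ^ 2)) - (c + ‖z‖ / (c * (a * b))) ^ 2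
        = ‖z‖ * (1 / a - 1 / b) ^ 2 := by field_simp; ring
    rw [← sub_nonneg, this]
    positivity
  rw [← sq_lt_one_iff₀ (by positivity), mul_pow]
  calc _ ≤ (transferEnergy r p * transferEnergy r p') *
        ((c + ‖z‖ / (c * a ^ 2)) * (c + ‖z‖ / (c * b ^ 2))) := by gcongr
    _ = (transferEnergy r p * (c + ‖z‖ / (c * a ^ 2))) *
        (transferEnergy r p' * (c + ‖z‖ / (c * b ^ 2))) := by ring
    _ < 1 := mul_lt_one_of_nonneg_of_lt_one_left (by positivity) hlt hlt'.le

lemma canonicalMap_sub (hp : ∀ i, (r i : ℂ) ≠ p) (hp' : ∀ i, (r i : ℂ) ≠ p') :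
    canonicalMap c r p - canonicalMap c r p' = (p - p') * canonicalMapSlope c r p p' := by
  rw [canonicalMap, canonicalMap, canonicalMapSlope]
  linear_combination (c * (c * (transfer r p + transfer r p') - p)) * transfer_sub hp hp'

lemma canonicalMapSlope_eq (hc : c ≠ 0) (hz : z ≠ 0) (h : canonicalMap c r p = z)
    (h' : canonicalMap c r p' = z) :
    canonicalMapSlope c r p p' = c * transfer r p' * (-1 + transferSlope r p p' *
      (c + z / (c * (transfer r p * transfer r p')))) := by
  have hq := transfer_ne_zero hz h
  have hq' := transfer_ne_zero hz h'
  have hc' : (c : ℂ) ≠ 0 := Complex.ofReal_ne_zero.2 hc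
  have hfactor : c * (transfer r p + transfer r p') - p
      = transfer r p' * (c + z / (c * (transfer r p * transfer r p'))) := by
    nth_rw 2 [eq_sub_inv_of_canonicalMap_eq hc hz h]
    field_simp
    ring
  rw [canonicalMapSlope, hfactor]
  ring

lemma canonicalMapSlope_ne_zero [Nonempty ι] (hr : ∀ i, 0 < r i) (hc : 0 < c)
    (hp : p ∈ canonicalDomain c r) (hp' : p' ∈ canonicalDomain c r)
    (h : canonicalMap c r p = canonicalMap c r p') : canonicalMapSlope c r p p' ≠ 0 := by
  have hz0 := ne_zero_of_im_pos hp.2.1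
  rw [canonicalMapSlope_eq hc.ne' hz0 rfl h.symm]
  refine mul_ne_zero (mul_ne_zero (Complex.ofReal_ne_zero.2 hc.ne')
    (transfer_ne_zero hz0 h.symm)) fun h0 => ?_
  refine (norm_transferSlope_mul_lt_one hr hc hp hp' rfl h.symm).not_ge ?_
  calc (1 : ℝ) = ‖transferSlope r p p' *
        (c + canonicalMap c r p / (c * (transfer r p * transfer r p')))‖ := by
        rw [eq_neg_of_add_eq_zero_right h0, neg_neg, norm_one]
    _ ≤ _ := by
        rw [norm_mul]
        gcongr
        refine (norm_add_le _ _).trans_eq ?_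
        simp [abs_of_pos hc]

lemma injOn_canonicalMap [Nonempty ι] (hr : ∀ i, 0 < r i) (hc : 0 < c) :
    InjOn (canonicalMap c r) (canonicalDomain c r) := by
  intro p hp p' hp' h
  have hsub := canonicalMap_sub (c := c) (ne_of_mem_canonicalDomain hp)
    (ne_of_mem_canonicalDomain hp')
  rw [h, sub_self, eq_comm, mul_eq_zero] at hsub
  exact sub_eq_zero.1 (hsub.resolve_right (canonicalMapSlope_ne_zero hr hc hp hp' h))

lemma hasStrictDerivAt_canonicalMap (hp : ∀ i, (r i : ℂ) ≠ p) :
    HasStrictDerivAt (canonicalMap c r) (canonicalMapSlope c r p p) p := by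
  have h := hasStrictDerivAt_transfer hp
  refine ((h.const_mul (-c : ℂ)).mul
    ((hasStrictDerivAt_id p).sub (h.const_mul (c : ℂ)))).congr_deriv ?_
  simp only [id, canonicalMapSlope, Pi.sub_apply]
  ring

lemma continuousAt_canonicalMap (hp : ∀ i, (r i : ℂ) ≠ p) : ContinuousAt (canonicalMap c r) p :=
  (hasStrictDerivAt_canonicalMap hp).hasDerivAt.continuousAt

lemma continuousAt_neg_canonicalMap_div (hp : ∀ i, (r i : ℂ) ≠ p) (hp0 : p ≠ 0) :
    ContinuousAt (fun w => -canonicalMap c r w / w) p :=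
  (continuousAt_canonicalMap hp).neg.div continuousAt_id hp0

lemma isOpen_canonicalDomain (c : ℝ) (r : ι → ℝ) : IsOpen (canonicalDomain c r) := by
  rw [isOpen_iff_mem_nhds]
  intro p hp
  have hri := ne_of_mem_canonicalDomain hp
  have him {f : ℂ → ℂ} (hf : ContinuousAt f p) (h : 0 < (f p).im) : ∀ᶠ w in 𝓝 p, 0 < (f w).im :=
    (Complex.continuous_im.continuousAt.comp hf).eventually (lt_mem_nhds h)
  exact (him continuousAt_id hp.1).and ((him (continuousAt_canonicalMap hri) hp.2.1).and
    (him (continuousAt_neg_canonicalMap_div hri (ne_zero_of_im_pos hp.1)) hp.2.2))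

lemma isOpen_image_canonicalMap [Nonempty ι] (hr : ∀ i, 0 < r i) (hc : 0 < c) :
    IsOpen (canonicalMap c r '' canonicalDomain c r) := by
  rw [isOpen_iff_mem_nhds]
  rintro _ ⟨p, hp, rfl⟩
  rw [← (hasStrictDerivAt_canonicalMap (c := c) (ne_of_mem_canonicalDomain hp)).map_nhds_eq
    (canonicalMapSlope_ne_zero hr hc hp hp rfl)]
  exact image_mem_map ((isOpen_canonicalDomain c r).mem_nhds hp)

lemma tendsto_canonicalMap_cobounded [Nonempty ι] (hr : ∀ i, 0 < r i) (hc : c ≠ 0) :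
    Tendsto (canonicalMap c r) (cobounded ℂ) (cobounded ℂ) := by
  have hq := tendsto_transfer_cobounded r
  have hmean : (-𝔼 i, (r i : ℂ)) ≠ 0 := by
    rw [neg_ne_zero]
    exact_mod_cast (Finset.expect_pos (fun i _ => hr i) Finset.univ_nonempty).ne'
  have hsub : Tendsto (fun p => ‖p - c * transfer r p‖) (cobounded ℂ) atTop := by
    refine tendsto_atTop_mono (fun p => norm_sub_norm_le p _) ?_
    simpa only [sub_eq_add_neg] using
      tendsto_norm_cobounded_atTop.atTop_add (hq.const_mul (c : ℂ)).norm.neg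
  rw [← tendsto_norm_atTop_iff_cobounded]
  simp only [canonicalMap, norm_mul]
  exact Tendsto.pos_mul_atTop (norm_pos_iff.2
    (mul_ne_zero (neg_ne_zero.2 (Complex.ofReal_ne_zero.2 hc)) hmean))
    (by simpa only [norm_mul] using (hq.const_mul (-c : ℂ)).norm) hsub

lemma mul_sq_le_card_mul_norm_sub_sq (hr : ∀ i, 0 < r i) (hc : 0 < c)
    (hp : p ∈ canonicalDomain c r) (i : ι) :
    c * r i ^ 2 ≤ Fintype.card ι * ‖(r i : ℂ) - p‖ ^ 2 := by
  have : Nonempty ι := ⟨i⟩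
  have hnorm := norm_pos_iff.2 (sub_ne_zero.2 (ne_of_mem_canonicalDomain hp i))
  have h := (sq_le_card_mul_transferEnergy r p i).trans
    (mul_le_mul_of_nonneg_left (transferEnergy_lt_inv hr hc hp).le (Nat.cast_nonneg _))
  rw [div_pow, div_le_iff₀ (by positivity)] at h
  calc c * r i ^ 2 ≤ c * (Fintype.card ι * c⁻¹ * ‖(r i : ℂ) - p‖ ^ 2) := by gcongr
    _ = Fintype.card ι * ‖(r i : ℂ) - p‖ ^ 2 := by field_simp

variable [Nonempty ι]

lemma norm_ratioMean_sq_lt_inv (hr : ∀ i, 0 < r i) (hc : 0 < c) (hp : p ∈ canonicalDomain c r) :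
    ‖ratioMean r p‖ ^ 2 < c⁻¹ :=
  (norm_ratioMean_sq_le r p).trans_lt (transferEnergy_lt_inv hr hc hp)

lemma exists_le_nhds_of_tendsto_canonicalMap (hr : ∀ i, 0 < r i) (hc : 0 < c) {F : Ultrafilter ℂ}
    (hF : canonicalDomain c r ∈ F) (h : Tendsto (canonicalMap c r) F (𝓝 z)) :
    ∃ p, (F : Filter ℂ) ≤ 𝓝 p ∧ (∀ i, (r i : ℂ) ≠ p) ∧ canonicalMap c r p = z ∧ 0 ≤ p.im := by
  have hbdd : ¬ (F : Filter ℂ) ≤ cobounded ℂ := fun hle =>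
    h.not_tendsto (Metric.disjoint_nhds_cobounded z)
      ((tendsto_canonicalMap_cobounded hr hc.ne').mono_left hle)
  obtain ⟨s, hs, hsF⟩ := Filter.not_le.1 hbdd
  have hcompact : IsCompact (closure sᶜ) := (isBounded_compl_iff.2 hs).isCompact_closure
  obtain ⟨p, -, hp⟩ := hcompact.ultrafilter_le_nhds' F
    (mem_of_superset (Ultrafilter.compl_mem_iff_notMem.2 hsF) subset_closure)
  have hri : ∀ i, (r i : ℂ) ≠ p := by
    rintro i rfl
    have hlim : Tendsto (fun w : ℂ => Fintype.card ι * ‖(r i : ℂ) - w‖ ^ 2) F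
        (𝓝 (Fintype.card ι * ‖(r i : ℂ) - r i‖ ^ 2)) :=
      (Continuous.tendsto (by fun_prop) (r i : ℂ)).mono_left hp
    have hle := ge_of_tendsto hlim
      (mem_of_superset hF fun w hw => mul_sq_le_card_mul_norm_sub_sq hr hc hw i)
    rw [sub_self, norm_zero, zero_pow two_ne_zero, mul_zero] at hle
    exact hle.not_gt (mul_pos hc (pow_pos (hr i) 2))
  exact ⟨p, hp, hri, tendsto_nhds_unique ((continuousAt_canonicalMap hri).tendsto.mono_left hp) h,
    ge_of_tendsto ((Complex.continuous_im.tendsto p).mono_left hp)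
      (mem_of_superset hF fun w hw => hw.1.le)⟩

lemma closure_image_canonicalMap_inter_subset (hr : ∀ i, 0 < r i) (hc : 0 < c) :
    closure (canonicalMap c r '' canonicalDomain c r) ∩ upperHalfPlaneSet ⊆
      canonicalMap c r '' canonicalDomain c r := by
  rintro z ⟨hz, hz_im : 0 < z.im⟩
  have hcluster : MapClusterPt z (𝓟 (canonicalDomain c r)) (canonicalMap c r) := by
    rwa [mem_closure_iff_clusterPt, ← map_principal] at hz
  obtain ⟨F, hF, hFz⟩ := mapClusterPt_iff_ultrafilter.1 hcluster
  have hD : canonicalDomain c r ∈ F := le_principal_iff.1 hF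
  obtain ⟨p, hp, hri, hpz, hp_im⟩ := exists_le_nhds_of_tendsto_canonicalMap hr hc hD hFz
  have hp0 : p ≠ 0 := by
    rintro rfl
    rw [canonicalMap_zero] at hpz
    simp [← hpz] at hz_im
  have hs : 0 ≤ (-z / p).im := by
    rw [← hpz]
    exact ge_of_tendsto ((Complex.continuous_im.continuousAt.comp
      (continuousAt_neg_canonicalMap_div hri hp0)).tendsto.mono_left hp)
      (mem_of_superset hD fun w hw => hw.2.2.le)
  refine ⟨p, mem_canonicalDomain_of_im_pos hc hz_im hpz
    (im_transfer_div_pos hr hri hp0 hz_im hs) ?_, hpz⟩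
  rw [im_transfer]
  exact mul_nonneg (transferEnergy_nonneg r p) hp_im

lemma ofReal_mul_I_mem_canonicalDomain (hr : ∀ i, 0 < r i) (hc : 0 < c) {Y : ℝ} (hY : 0 < Y)
    (hk : 2 * c * (ratioMean r (Y * Complex.I)).re < 1) :
    (Y : ℂ) * Complex.I ∈ canonicalDomain c r := by
  have hp_im : 0 < ((Y : ℂ) * Complex.I).im := by simpa using hY
  have hre := re_ratioMean_pos hr (p := Y * Complex.I) (by simp)
  have him := im_ratioMean_pos hr hp_im
  set k := ratioMean r (Y * Complex.I) with hkdef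
  have hmap : canonicalMap c r (Y * Complex.I) = ((c * Y ^ 2 : ℝ) : ℂ) * (k * (1 - c * k)) := by
    rw [canonicalMap_eq, ← hkdef, mul_pow, Complex.I_sq]
    push_cast
    ring
  have hdiv : -canonicalMap c r (Y * Complex.I) / (Y * Complex.I) =
      ((c * Y : ℝ) : ℂ) * (Complex.I * (k * (1 - c * k))) := by
    rw [canonicalMap_eq, ← hkdef, div_eq_iff (ne_zero_of_im_pos hp_im)]
    push_cast
    ring
  have him_eq : (k * (1 - c * k)).im = k.im * (1 - 2 * c * k.re) := by
    simp only [Complex.mul_im, Complex.mul_re, Complex.sub_re, Complex.sub_im, Complex.one_re,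
      Complex.one_im, Complex.ofReal_re, Complex.ofReal_im]
    ring
  have hre_eq : (Complex.I * (k * (1 - c * k))).im = k.re * (1 - c * k.re) + c * k.im ^ 2 := by
    simp only [Complex.I_re, Complex.I_im, Complex.mul_im, Complex.mul_re, Complex.sub_re,
      Complex.sub_im, Complex.one_re, Complex.one_im, Complex.ofReal_re, Complex.ofReal_im]
    ring
  refine ⟨hp_im, ?_, ?_⟩
  · rw [hmap, Complex.im_ofReal_mul, him_eq]
    exact mul_pos (by positivity) (mul_pos him (sub_pos.2 hk))
  · rw [hdiv, Complex.im_ofReal_mul, hre_eq]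
    have : 0 < 1 - c * k.re := by linarith [mul_pos hc hre]
    positivity

lemma canonicalDomain_nonempty (hr : ∀ i, 0 < r i) (hc : 0 < c) :
    (canonicalDomain c r).Nonempty := by
  have hcob : Tendsto (fun Y : ℝ => (Y : ℂ) * Complex.I) atTop (cobounded ℂ) := by
    rw [← tendsto_norm_atTop_iff_cobounded]
    simpa using tendsto_abs_atTop_atTop
  have hsmall : ∀ᶠ Y : ℝ in atTop, ‖ratioMean r (Y * Complex.I)‖ < (2 * c)⁻¹ :=
    ((tendsto_ratioMean_cobounded r).comp hcob).norm.eventually_lt_const (by simpa using hc)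
  obtain ⟨Y, hk, hY⟩ := (hsmall.and (Ioi_mem_atTop 0)).exists
  refine ⟨Y * Complex.I, ofReal_mul_I_mem_canonicalDomain hr hc hY ?_⟩
  rw [← lt_inv_mul_iff₀ (by positivity), mul_one]
  exact (Complex.re_le_norm _).trans_lt hk

lemma upperHalfPlaneSet_subset_image_canonicalMap (hr : ∀ i, 0 < r i) (hc : 0 < c) :
    upperHalfPlaneSet ⊆ canonicalMap c r '' canonicalDomain c r := by
  obtain ⟨p, hp⟩ := canonicalDomain_nonempty hr hc
  exact (convex_halfSpace_im_gt 0).isPreconnected.subset_of_closure_inter_subset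
    (isOpen_image_canonicalMap hr hc) ⟨_, hp.2.1, mem_image_of_mem _ hp⟩
    (closure_image_canonicalMap_inter_subset hr hc)

/-- The inverse of `canonicalMap c r` from the upper half-plane to `canonicalDomain c r`, with
unspecified values outside the upper half-plane. -/
def canonicalInv (c : ℝ) (r : ι → ℝ) : ℂ → ℂ :=
  Function.invFunOn (canonicalMap c r) (canonicalDomain c r)

lemma canonicalInv_mem (hr : ∀ i, 0 < r i) (hc : 0 < c) (hz : 0 < z.im) :
    canonicalInv c r z ∈ canonicalDomain c r :=
  Function.invFunOn_mem (upperHalfPlaneSet_subset_image_canonicalMap hr hc hz)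

lemma canonicalMap_canonicalInv (hr : ∀ i, 0 < r i) (hc : 0 < c) (hz : 0 < z.im) :
    canonicalMap c r (canonicalInv c r z) = z :=
  Function.invFunOn_eq (upperHalfPlaneSet_subset_image_canonicalMap hr hc hz)

lemma canonicalInv_canonicalMap (hr : ∀ i, 0 < r i) (hc : 0 < c) (hp : p ∈ canonicalDomain c r) :
    canonicalInv c r (canonicalMap c r p) = p :=
  injOn_canonicalMap hr hc (canonicalInv_mem hr hc hp.2.1) hp
    (canonicalMap_canonicalInv hr hc hp.2.1)

lemma differentiableAt_canonicalInv (hr : ∀ i, 0 < r i) (hc : 0 < c) (hz : 0 < z.im) :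
    DifferentiableAt ℂ (canonicalInv c r) z := by
  obtain ⟨p, hp, rfl⟩ := upperHalfPlaneSet_subset_image_canonicalMap hr hc hz
  have hderiv := hasStrictDerivAt_canonicalMap (c := c) (ne_of_mem_canonicalDomain hp)
  have hne := canonicalMapSlope_ne_zero hr hc hp hp rfl
  have hlocal := (hderiv.to_localInverse hne).hasDerivAt
  have hmem : ∀ᶠ w in 𝓝 (canonicalMap c r p),
      hderiv.localInverse _ _ _ hne w ∈ canonicalDomain c r := by
    refine hlocal.continuousAt.eventually_mem ?_
    rw [(hderiv.eventually_left_inverse hne).self_of_nhds]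
    exact (isOpen_canonicalDomain c r).mem_nhds hp
  refine (hlocal.congr_of_eventuallyEq ?_).differentiableAt
  filter_upwards [hmem, hderiv.eventually_right_inverse hne] with w hw hw'
  rw [← canonicalInv_canonicalMap hr hc hw, hw']

lemma continuousOn_canonicalInv (hr : ∀ i, 0 < r i) (hc : 0 < c) :
    ContinuousOn (canonicalInv c r) upperHalfPlaneSet := fun _ hz =>
  (differentiableAt_canonicalInv hr hc hz).continuousAt.continuousWithinAt

end CanonicalMap

lemma exists_tendsto_of_finite_cluster {X Y : Type*} [TopologicalSpace Y] [T2Space Y]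
    {l : Filter X} [l.NeBot] {f : X → Y} {K : Set Y} (hK : K.Finite)
    (hconn : ∀ s ∈ l, ∃ t ∈ l, t ⊆ s ∧ IsPreconnected (f '' t))
    (hcluster : ∀ F : Ultrafilter X, (F : Filter X) ≤ l → ∃ k ∈ K, Tendsto f F (𝓝 k)) :
    ∃ k ∈ K, Tendsto f l (𝓝 k) := by
  obtain ⟨k, hkK, hk⟩ := hcluster (Ultrafilter.of l) (Ultrafilter.of_le l)
  refine ⟨k, hkK, (tendsto_iff_ultrafilter f l (𝓝 k)).2 fun F hF => ?_⟩
  obtain ⟨k', hk'K, hk'⟩ := hcluster F hF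
  suffices k' = k by rwa [this] at hk'
  by_contra hne
  obtain ⟨U, hU, hdisj⟩ := hK.t2_separation
  set V := ⋃ j ∈ K \ {k}, U j with hV
  have hUV : Disjoint (U k) V := by
    rw [hV, disjoint_iUnion₂_right]
    exact fun j hj => hdisj hkK hj.1 (Ne.symm hj.2)
  have hcover : f ⁻¹' (U k ∪ V) ∈ l := by
    refine mem_iff_ultrafilter.2 fun G hG => ?_
    obtain ⟨j, hjK, hj⟩ := hcluster G hG
    refine mem_of_superset (hj ((hU j).2.mem_nhds (hU j).1)) (preimage_mono ?_)
    by_cases hjk : j = k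
    · exact hjk ▸ subset_union_left
    · exact subset_union_of_subset_right
        (subset_biUnion_of_mem (u := U) (show j ∈ K \ {k} from ⟨hjK, hjk⟩)) _
  obtain ⟨t, htl, htcover, hconn⟩ := hconn _ hcover
  obtain ⟨x, hxt, hxk⟩ := (Ultrafilter.of l).nonempty_of_mem
    (inter_mem (Ultrafilter.of_le l htl) (hk ((hU k).2.mem_nhds (hU k).1)))
  have hVopen : IsOpen V := isOpen_biUnion fun j _ => (hU j).2
  have htU : f '' t ⊆ U k := hconn.subset_left_of_subset_union (hU k).2 hVopen hUV
    (image_subset_iff.2 htcover) ⟨f x, mem_image_of_mem f hxt, hxk⟩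
  obtain ⟨y, hyt, hyk'⟩ := F.nonempty_of_mem
    (inter_mem (hF htl) (hk' ((hU k').2.mem_nhds (hU k').1)))
  exact (hdisj hk'K hkK hne).le_bot ⟨hyk', htU (mem_image_of_mem f hyt)⟩

lemma nhdsWithin_upperHalfPlaneSet_neBot {z : ℂ} (hz : 0 ≤ z.im) :
    (𝓝[upperHalfPlaneSet] z).NeBot := by
  rwa [← mem_closure_iff_nhdsWithin_neBot, Complex.closure_setOfPred_lt_im]

lemma exists_isPreconnected_image_of_mem_nhdsWithin {f : ℂ → ℂ}
    (hf : ContinuousOn f upperHalfPlaneSet) (x : ℂ) {s : Set ℂ} (hs : s ∈ 𝓝[upperHalfPlaneSet] x) :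
    ∃ t ∈ 𝓝[upperHalfPlaneSet] x, t ⊆ s ∧ IsPreconnected (f '' t) := by
  obtain ⟨ε, hε, hball⟩ := Metric.mem_nhdsWithin_iff.1 hs
  exact ⟨_, inter_mem (mem_nhdsWithin_of_mem_nhds (Metric.ball_mem_nhds x hε)) self_mem_nhdsWithin,
    hball, ((convex_ball x ε).inter (convex_halfSpace_im_gt 0)).isPreconnected.image f
      (hf.mono inter_subset_right)⟩

lemma tendsto_ofReal_mul_I_nhdsGT_zero :
    Tendsto (fun y : ℝ => (y : ℂ) * Complex.I) (𝓝[>] 0) (𝓝[upperHalfPlaneSet] 0) := by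
  refine tendsto_nhdsWithin_iff.2 ⟨?_, ?_⟩
  · have hcont : Continuous (fun y : ℝ => (y : ℂ) * Complex.I) := by fun_prop
    simpa using (hcont.tendsto 0).mono_left nhdsWithin_le_nhds
  · filter_upwards [self_mem_nhdsWithin] with y hy
    simpa using hy

section BoundaryBehavior

variable {ι : Type*} [Fintype ι] {r : ι → ℝ} {c : ℝ} {p z : ℂ}

open Polynomial in
lemma exists_polynomial_eval_eq_transfer_mul (r : ι → ℝ) :
    ∃ A Q : ℂ[X], ∀ p, (∀ i, (r i : ℂ) ≠ p) →
      A.eval p ≠ 0 ∧ Q.eval p = transfer r p * A.eval p := by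
  classical
  refine ⟨∏ i, (C (r i : ℂ) - X), C (Fintype.card ι : ℂ)⁻¹ *
    ∑ i, C (r i : ℂ) * X * ∏ j ∈ Finset.univ.erase i, (C (r j : ℂ) - X), fun p hp => ⟨?_, ?_⟩⟩
  · simpa [eval_prod, Finset.prod_ne_zero_iff, sub_ne_zero] using hp
  · simp only [eval_mul, eval_C, eval_finsetSum, eval_X, eval_prod, eval_sub, transfer_eq_expect,
      Fintype.expect_eq_sum_div_card, Finset.sum_div, Finset.sum_mul, Finset.mul_sum]
    refine Finset.sum_congr rfl fun i _ => ?_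
    rw [← Finset.mul_prod_erase Finset.univ _ (Finset.mem_univ i)]
    have := sub_ne_zero.2 (hp i)
    field_simp

variable [Nonempty ι]

open Polynomial in
lemma finite_canonicalMap_fiber (hr : ∀ i, 0 < r i) (hc : c ≠ 0) (z : ℂ) :
    {p : ℂ | (∀ i, (r i : ℂ) ≠ p) ∧ canonicalMap c r p = z}.Finite := by
  obtain ⟨A, Q, hAQ⟩ := exists_polynomial_eval_eq_transfer_mul r
  set B : ℂ[X] := C z * A ^ 2 + C (c : ℂ) * Q * (X * A - C (c : ℂ) * Q) with hB
  have hBeval : ∀ p, (∀ i, (r i : ℂ) ≠ p) →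
      B.eval p = (z - canonicalMap c r p) * A.eval p ^ 2 := fun p hp => by
    simp only [hB, eval_add, eval_mul, eval_C, eval_pow, eval_sub, eval_X, (hAQ p hp).2,
      canonicalMap]
    ring
  have hB0 : B ≠ 0 := fun h0 => by
    have hpole : ∀ᶠ p in cobounded ℂ, ∀ i, (r i : ℂ) ≠ p :=
      eventually_all.2 fun i => (eventually_ne_cobounded (r i : ℂ)).mono fun p hp => hp.symm
    obtain ⟨p, hp, hpz⟩ := (hpole.and ((tendsto_canonicalMap_cobounded hr hc).eventually
      (eventually_ne_cobounded z))).exists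
    have h := hBeval p hp
    rw [h0, eval_zero] at h
    exact mul_ne_zero (sub_ne_zero.2 hpz.symm) (pow_ne_zero 2 (hAQ p hp).1) h.symm
  refine (finite_setOfPred_isRoot hB0).subset fun p hp => ?_
  rw [mem_ofPred_eq, IsRoot, hBeval p hp.1, hp.2, sub_self, zero_mul]

lemma exists_tendsto_canonicalInv (hr : ∀ i, 0 < r i) (hc : 0 < c) (x : ℝ) :
    ∃ p : ℂ, ((∀ i, (r i : ℂ) ≠ p) ∧ canonicalMap c r p = x) ∧
      Tendsto (canonicalInv c r) (𝓝[upperHalfPlaneSet] x) (𝓝 p) := by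
  have := nhdsWithin_upperHalfPlaneSet_neBot (z := x) (by simp)
  refine exists_tendsto_of_finite_cluster (finite_canonicalMap_fiber hr hc.ne' x)
    (fun s => exists_isPreconnected_image_of_mem_nhdsWithin (continuousOn_canonicalInv hr hc) x)
    fun F hF => ?_
  have hFU : upperHalfPlaneSet ∈ F := hF self_mem_nhdsWithin
  have hdom : canonicalDomain c r ∈ F.map (canonicalInv c r) :=
    Ultrafilter.mem_map.2 (mem_of_superset hFU fun w hw => canonicalInv_mem hr hc hw)
  have hlim : Tendsto (canonicalMap c r) (F.map (canonicalInv c r)) (𝓝 (x : ℂ)) := by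
    rw [Ultrafilter.coe_map, tendsto_map'_iff]
    refine (tendsto_id.mono_left (hF.trans nhdsWithin_le_nhds)).congr' ?_
    filter_upwards [hFU] with w hw
    exact (canonicalMap_canonicalInv hr hc hw).symm
  obtain ⟨p, hp, hpole, hpx, -⟩ := exists_le_nhds_of_tendsto_canonicalMap hr hc hdom hlim
  exact ⟨p, ⟨hpole, hpx⟩, hp⟩

lemma im_transfer_pos (hr : ∀ i, 0 < r i) (hp : 0 < p.im) : 0 < (transfer r p).im := by
  rw [im_transfer]
  exact mul_pos (transferEnergy_pos hr fun i => ofReal_ne_of_im_pos hp (r i)) hp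

lemma im_transfer_canonicalInv_div_pos (hr : ∀ i, 0 < r i) (hc : 0 < c) (hz : 0 < z.im) :
    0 < (transfer r (canonicalInv c r z) / z).im := by
  have hp := canonicalInv_mem hr hc hz
  refine im_transfer_div_pos hr (ne_of_mem_canonicalDomain hp) (ne_zero_of_im_pos hp.1) hz ?_
  simpa only [canonicalMap_canonicalInv hr hc hz] using hp.2.2.le

lemma re_canonicalInv_neg (hr : ∀ i, 0 < r i) (hc : 0 < c) (hz : 0 < z.im) (hz' : z.re ≤ 0) :
    (canonicalInv c r z).re < 0 := by
  have hz0 := ne_zero_of_im_pos hz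
  have hq := im_transfer_pos hr (canonicalInv_mem hr hc hz).1
  have ht := im_transfer_canonicalInv_div_pos hr hc hz
  have hp := eq_sub_inv_of_canonicalMap_eq hc.ne' hz0 (canonicalMap_canonicalInv hr hc hz)
  set q := transfer r (canonicalInv c r z)
  obtain ⟨t, hqt⟩ : ∃ t, q = z * t := ⟨q / z, by field_simp⟩
  rw [hqt, mul_div_cancel_left₀ t hz0] at ht hp
  rw [hqt, Complex.mul_im] at hq
  have htre : 0 < t.re := by
    by_contra! htre
    nlinarith [mul_nonpos_of_nonpos_of_nonneg hz' ht.le, mul_nonpos_of_nonneg_of_nonpos hz.le htre]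
  have hqre : (z * t).re < 0 := by
    rw [Complex.mul_re]
    linarith [mul_nonpos_of_nonpos_of_nonneg hz' htre.le, mul_pos hz ht]
  have hinv : 0 < ((c * t : ℂ)⁻¹).re := by
    rw [Complex.inv_re, Complex.re_ofReal_mul]
    exact div_pos (mul_pos hc htre) (Complex.normSq_pos.2
      (mul_ne_zero (Complex.ofReal_ne_zero.2 hc.ne') (ne_zero_of_im_pos ht)))
  rw [hp, Complex.sub_re, Complex.re_ofReal_mul]
  linarith [mul_neg_of_pos_of_neg hc hqre]

lemma norm_ratioMean_lt_one (hr : ∀ i, 0 < r i) (hp : p.re ≤ 0) (hp0 : p ≠ 0) :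
    ‖ratioMean r p‖ < 1 := by
  have hterm : ∀ i, ‖(r i : ℂ) / (r i - p)‖ < 1 := fun i => by
    have hlt : r i ^ 2 < ‖(r i : ℂ) - p‖ ^ 2 := by
      rw [Complex.sq_norm, Complex.normSq_apply, Complex.sub_re, Complex.sub_im, Complex.ofReal_re,
        Complex.ofReal_im]
      have hpos := Complex.normSq_pos.2 hp0
      rw [Complex.normSq_apply] at hpos
      nlinarith [mul_nonneg (hr i).le (neg_nonneg.2 hp)]
    have hlt' := lt_of_pow_lt_pow_left₀ 2 (norm_nonneg _) hlt
    rw [norm_div, Complex.norm_real, Real.norm_of_nonneg (hr i).le]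
    exact (div_lt_one ((hr i).trans hlt')).2 hlt'
  rw [ratioMean, Fintype.expect_eq_sum_div_card, norm_div, Complex.norm_natCast,
    div_lt_one (by positivity)]
  calc ‖∑ i, (r i : ℂ) / (r i - p)‖ ≤ ∑ i, ‖(r i : ℂ) / (r i - p)‖ := norm_sum_le _ _
    _ < ∑ _i : ι, 1 := Finset.sum_lt_sum_of_nonempty Finset.univ_nonempty fun i _ => hterm i
    _ = Fintype.card ι := by simp

lemma eq_zero_of_canonicalMap_eq_zero (hr : ∀ i, 0 < r i) (hc : 0 < c) (hc1 : c ≤ 1)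
    (hp : p.re ≤ 0) (h : canonicalMap c r p = 0) : p = 0 := by
  by_contra hp0
  have hc' : (c : ℂ) ≠ 0 := Complex.ofReal_ne_zero.2 hc.ne'
  have hk0 : ratioMean r p ≠ 0 := fun h0 => by simpa [h0] using re_ratioMean_pos hr hp
  rw [canonicalMap_eq] at h
  have hk : c * ratioMean r p = 1 := (sub_eq_zero.1 ((mul_eq_zero.1 h).resolve_left
    (mul_ne_zero (mul_ne_zero (neg_ne_zero.2 hc') (pow_ne_zero 2 hp0)) hk0))).symm
  have hnorm : ‖(c * ratioMean r p : ℂ)‖ < 1 := by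
    rw [norm_mul, Complex.norm_real, Real.norm_of_nonneg hc.le]
    exact (mul_le_of_le_one_left (norm_nonneg _) hc1).trans_lt (norm_ratioMean_lt_one hr hp hp0)
  rw [hk, norm_one] at hnorm
  exact lt_irrefl 1 hnorm

lemma tendsto_canonicalInv_zero (hr : ∀ i, 0 < r i) (hc : 0 < c) (hc1 : c ≤ 1) :
    Tendsto (canonicalInv c r) (𝓝[upperHalfPlaneSet] 0) (𝓝 0) := by
  obtain ⟨p, ⟨-, hp0⟩, hlim⟩ := exists_tendsto_canonicalInv hr hc 0
  rw [Complex.ofReal_zero] at hlim hp0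
  suffices p.re ≤ 0 by rwa [eq_zero_of_canonicalMap_eq_zero hr hc hc1 this hp0] at hlim
  refine le_of_tendsto ((Complex.continuous_re.tendsto p).comp
    (hlim.comp tendsto_ofReal_mul_I_nhdsGT_zero)) ?_
  filter_upwards [self_mem_nhdsWithin] with y hy
  exact (re_canonicalInv_neg hr hc (by simpa using hy) (by simp)).le

lemma norm_le_mul_norm_canonicalInv_sq (hr : ∀ i, 0 < r i) (hc : 0 < c) (hz : 0 < z.im) :
    ‖z‖ ≤ c * √c⁻¹ * (1 + c * √c⁻¹) * ‖canonicalInv c r z‖ ^ 2 := by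
  have hk : ‖ratioMean r (canonicalInv c r z)‖ ≤ √c⁻¹ :=
    Real.le_sqrt_of_sq_le (norm_ratioMean_sq_lt_inv hr hc (canonicalInv_mem hr hc hz)).le
  have hnorm_c : ‖(c : ℂ)‖ = c := by rw [Complex.norm_real, Real.norm_of_nonneg hc.le]
  have hfactor : ‖(1 - c * ratioMean r (canonicalInv c r z) : ℂ)‖ ≤ 1 + c * √c⁻¹ := by
    refine (norm_sub_le _ _).trans ?_
    rw [norm_one, norm_mul, hnorm_c]
    gcongr
  calc ‖z‖ = c * ‖canonicalInv c r z‖ ^ 2 * ‖ratioMean r (canonicalInv c r z)‖ *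
        ‖(1 - c * ratioMean r (canonicalInv c r z) : ℂ)‖ := by
        conv_lhs => rw [← canonicalMap_canonicalInv hr hc hz, canonicalMap_eq]
        rw [norm_mul, norm_mul, norm_mul, norm_neg, norm_pow, hnorm_c]
    _ ≤ c * ‖canonicalInv c r z‖ ^ 2 * √c⁻¹ * (1 + c * √c⁻¹) := by gcongr
    _ = c * √c⁻¹ * (1 + c * √c⁻¹) * ‖canonicalInv c r z‖ ^ 2 := by ring

lemma tendsto_canonicalInv_cobounded (hr : ∀ i, 0 < r i) (hc : 0 < c) :
    Tendsto (canonicalInv c r) (cobounded ℂ ⊓ 𝓟 upperHalfPlaneSet) (cobounded ℂ) := by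
  have hC : 0 < c * √c⁻¹ * (1 + c * √c⁻¹) := by positivity
  have hsq : Tendsto (fun z => ‖canonicalInv c r z‖ ^ 2) (cobounded ℂ ⊓ 𝓟 upperHalfPlaneSet)
      atTop := by
    refine tendsto_atTop_mono' _ ?_
      ((tendsto_norm_cobounded_atTop.mono_left inf_le_left).atTop_div_const hC)
    filter_upwards [mem_inf_of_right (mem_principal_self _)] with z hz
    exact (div_le_iff₀' hC).2 (norm_le_mul_norm_canonicalInv_sq hr hc hz)
  rw [← tendsto_norm_atTop_iff_cobounded]
  simpa [Function.comp_def, Real.sqrt_sq] using Real.tendsto_sqrt_atTop.comp hsq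

end BoundaryBehavior

section HalfPlaneCauchy

/-- The closed upper half-plane, as a subset of `ℂ`. -/
abbrev closedUpperHalfPlaneSet : Set ℂ := {z | 0 ≤ z.im}

variable {F : ℂ → ℂ} {z : ℂ}

lemma norm_intervalIntegral_le_of_norm_le (hF : ContinuousOn F closedUpperHalfPlaneSet)
    (hF' : DifferentiableOn ℂ F upperHalfPlaneSet) {X B : ℝ} (hX : 0 ≤ X)
    (hB : ∀ w : ℂ, 0 ≤ w.im → X ≤ ‖w‖ → ‖F w‖ ≤ B) :
    ‖∫ x in (-X)..X, F x‖ ≤ 4 * B * X := by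
  have hrect := Complex.integral_boundary_rect_eq_zero_of_continuousOn_of_differentiableOn F
    ((-X : ℝ) : ℂ) ((X : ℂ) + X * Complex.I)
    (hF.mono fun w hw => by
      have him := hw.2
      simp only [Complex.add_im, Complex.ofReal_im, Complex.mul_im, Complex.ofReal_re,
        Complex.I_im, Complex.I_re, mul_one, mul_zero, add_zero, zero_add, uIcc_of_le hX] at him
      exact him.1)
    (hF'.mono fun w hw => by
      have him := hw.2
      simp only [Complex.add_im, Complex.ofReal_im, Complex.mul_im, Complex.ofReal_re,
        Complex.I_im, Complex.I_re, mul_one, mul_zero, add_zero, zero_add, min_eq_left hX] at him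
      exact him.1)
  simp only [Complex.ofReal_re, Complex.ofReal_im, Complex.add_re, Complex.add_im, Complex.mul_re,
    Complex.mul_im, Complex.I_re, Complex.I_im, Complex.ofReal_zero, zero_mul, mul_zero, mul_one,
    add_zero, zero_add, sub_zero] at hrect
  have htop : ‖∫ x in (-X)..X, F (x + X * Complex.I)‖ ≤ B * |X - -X| := by
    refine intervalIntegral.norm_integral_le_of_norm_le_const fun x _ => hB _ (by simpa using hX) ?_
    simpa using (le_abs_self X).trans (by simpa using Complex.abs_im_le_norm (x + X * Complex.I))
  have hside : ∀ s : ℝ, X ≤ |s| →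
      ‖∫ y in (0 : ℝ)..X, F (s + y * Complex.I)‖ ≤ B * |X - 0| := fun s hs => by
    refine intervalIntegral.norm_integral_le_of_norm_le_const fun y hy => hB _ ?_ ?_
    · simpa using (uIoc_of_le hX ▸ hy).1.le
    · exact hs.trans (by simpa using Complex.abs_re_le_norm (s + y * Complex.I))
  have hbottom : ∫ x in (-X)..X, F x = (∫ x in (-X)..X, F (x + X * Complex.I))
      - Complex.I • (∫ y in (0 : ℝ)..X, F (X + y * Complex.I))
      + Complex.I • (∫ y in (0 : ℝ)..X, F ((-X : ℝ) + y * Complex.I)) := by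
    linear_combination hrect
  have hright := hside X (le_abs_self X)
  have hleft := hside (-X) (by simp [le_abs_self])
  rw [sub_neg_eq_add, abs_of_nonneg (by linarith : 0 ≤ X + X)] at htop
  rw [sub_zero, abs_of_nonneg hX] at hright hleft
  rw [hbottom]
  refine (norm_add_le _ _).trans ((add_le_add_left (norm_sub_le _ _) _).trans ?_)
  rw [norm_smul, norm_smul, Complex.norm_I, one_mul, one_mul]
  linarith

lemma integral_eq_zero_of_tendsto_mul (hF : ContinuousOn F closedUpperHalfPlaneSet)
    (hF' : DifferentiableOn ℂ F upperHalfPlaneSet)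
    (hlim : Tendsto (fun w => w * F w) (cobounded ℂ ⊓ 𝓟 closedUpperHalfPlaneSet) (𝓝 0))
    (hint : Integrable fun x : ℝ => F x) : ∫ x : ℝ, F x = 0 := by
  refine tendsto_nhds_unique
    (intervalIntegral_tendsto_integral hint tendsto_neg_atTop_atBot tendsto_id) ?_
  rw [NormedAddGroup.tendsto_nhds_zero]
  intro ε hε
  have hsmall := (NormedAddGroup.tendsto_nhds_zero.1 hlim) (ε / 8) (by positivity)
  rw [eventually_inf_principal, ← comap_norm_atTop, eventually_comap, eventually_atTop] at hsmall
  obtain ⟨N, hN⟩ := hsmall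
  filter_upwards [eventually_ge_atTop N, eventually_gt_atTop 0] with X hXN hX
  have hbound : ∀ w : ℂ, 0 ≤ w.im → X ≤ ‖w‖ → ‖F w‖ ≤ ε / 8 / X := fun w hw hXw => by
    have hmul := (hN ‖w‖ (hXN.trans hXw) w rfl hw).le
    rw [norm_mul] at hmul
    rw [le_div_iff₀' hX]
    exact (mul_le_mul_of_nonneg_right hXw (norm_nonneg _)).trans hmul
  calc ‖∫ x in (-X)..(id X), F x‖ ≤ 4 * (ε / 8 / X) * X :=
        norm_intervalIntegral_le_of_norm_le hF hF' hX.le hbound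
    _ = ε / 2 := by field_simp; norm_num
    _ < ε := half_lt_self hε

lemma sub_conj_ne_zero (hz : 0 < z.im) {w : ℂ} (hw : 0 ≤ w.im) : w - conj z ≠ 0 := fun h => by
  have him := congrArg Complex.im h
  rw [Complex.sub_im, Complex.conj_im, Complex.zero_im] at him
  linarith

lemma tendsto_div_sub_cobounded (z : ℂ) :
    Tendsto (fun w => w / (w - z)) (cobounded ℂ) (𝓝 1) := by
  have hsub : Tendsto (fun w => w - z) (cobounded ℂ) (cobounded ℂ) := tendsto_sub_const_cobounded z
  have hlim := ((tendsto_inv₀_cobounded.comp hsub).const_mul z).const_add 1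
  rw [mul_zero, add_zero] at hlim
  refine hlim.congr' ?_
  filter_upwards [eventually_ne_cobounded z] with w hw
  have := sub_ne_zero.2 hw
  simp only [Function.comp_apply]
  field_simp
  ring

lemma integrable_div_sub_conj
    (hz : z.im ≠ 0) (hint : Integrable fun x : ℝ => F x / (x - z)) :
    Integrable fun x : ℝ => F x / (x - conj z) := by
  have hne : ∀ x : ℝ, (x : ℂ) - z ≠ 0 := fun x h => hz (by simpa using congrArg Complex.im h)
  have hconj : ∀ x : ℝ, (x : ℂ) - conj z = conj ((x : ℂ) - z) := fun x => by simp
  refine (hint.bdd_mul (c := 1) (f := fun x : ℝ => ((x : ℂ) - z) / (x - conj z))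
    (Measurable.aestronglyMeasurable (by fun_prop)) (Eventually.of_forall fun x => ?_)).congr
    (Eventually.of_forall fun x => ?_)
  · rw [norm_div, hconj, Complex.norm_conj]
    exact div_self_le_one _
  · exact div_mul_div_cancel₀' (hne x) _ _

lemma integral_div_sub_conj_eq_zero (hF : ContinuousOn F closedUpperHalfPlaneSet)
    (hF' : DifferentiableOn ℂ F upperHalfPlaneSet)
    (hlim : Tendsto F (cobounded ℂ ⊓ 𝓟 closedUpperHalfPlaneSet) (𝓝 0)) (hz : 0 < z.im)
    (hint : Integrable fun x : ℝ => F x / (x - z)) : ∫ x : ℝ, F x / (x - conj z) = 0 := by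
  refine integral_eq_zero_of_tendsto_mul (F := fun w => F w / (w - conj z))
    (hF.div (by fun_prop) fun w hw => sub_conj_ne_zero hz hw)
    (hF'.div (by fun_prop) fun w hw => sub_conj_ne_zero hz (le_of_lt hw)) ?_
    (integrable_div_sub_conj hz.ne' hint)
  have hmul := hlim.mul ((tendsto_div_sub_cobounded (conj z)).mono_left inf_le_left)
  rw [zero_mul] at hmul
  exact hmul.congr fun w => by ring

lemma tendsto_mul_dslope_div_sub
    (hlim : Tendsto F (cobounded ℂ ⊓ 𝓟 closedUpperHalfPlaneSet) (𝓝 0)) (z z' : ℂ) :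
    Tendsto (fun w => w * (dslope F z w / (w - z')))
      (cobounded ℂ ⊓ 𝓟 closedUpperHalfPlaneSet) (𝓝 0) := by
  have hinv : Tendsto (fun w => (w - z)⁻¹) (cobounded ℂ) (𝓝 0) :=
    tendsto_inv₀_cobounded.comp (tendsto_sub_const_cobounded z)
  have hmul := ((hlim.sub_const (F z)).mul (hinv.mono_left inf_le_left)).mul
    ((tendsto_div_sub_cobounded z').mono_left inf_le_left)
  rw [mul_zero, zero_mul] at hmul
  refine hmul.congr' (Eventually.filter_mono inf_le_left ?_)
  filter_upwards [eventually_ne_cobounded z] with w hw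
  rw [dslope_of_ne _ hw, slope_def_field]
  ring

lemma integral_dslope_div_sub_conj_eq_zero (hF : ContinuousOn F closedUpperHalfPlaneSet)
    (hF' : DifferentiableOn ℂ F upperHalfPlaneSet)
    (hlim : Tendsto F (cobounded ℂ ⊓ 𝓟 closedUpperHalfPlaneSet) (𝓝 0)) (hz : 0 < z.im)
    (hint : Integrable fun x : ℝ => dslope F z x / (x - conj z)) :
    ∫ x : ℝ, dslope F z x / (x - conj z) = 0 := by
  have hnhds : upperHalfPlaneSet ∈ 𝓝 z :=
    isOpen_upperHalfPlaneSet.mem_nhds hz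
  have hnhds' : closedUpperHalfPlaneSet ∈ 𝓝 z :=
    mem_of_superset hnhds fun w (hw : 0 < w.im) => hw.le
  refine integral_eq_zero_of_tendsto_mul (F := fun w => dslope F z w / (w - conj z))
    (ContinuousOn.div ?_ (by fun_prop) fun w hw => sub_conj_ne_zero hz hw)
    (DifferentiableOn.div ?_ (by fun_prop) fun w hw => sub_conj_ne_zero hz (le_of_lt hw))
    (tendsto_mul_dslope_div_sub hlim z _) hint
  · exact (continuousOn_dslope hnhds').2 ⟨hF, hF'.differentiableAt hnhds⟩
  · exact (Complex.differentiableOn_dslope hnhds).2 hF'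

lemma cauchyKernel_eq (x a : ℝ) {b : NNReal} (hb : (0 : ℝ) < b) :
    (b : ℝ) / ((a - x) ^ 2 + b ^ 2) = Real.pi * ProbabilityTheory.cauchyPDFReal x b a := by
  rw [ProbabilityTheory.cauchyPDFReal_def]
  have : 0 < (a - x) ^ 2 + (b : ℝ) ^ 2 := by positivity
  field_simp

lemma integrable_cauchyKernel (x : ℝ) {b : ℝ} (hb : 0 < b) :
    Integrable fun a : ℝ => b / ((a - x) ^ 2 + b ^ 2) := by
  lift b to NNReal using hb.le
  simp_rw [cauchyKernel_eq x _ hb]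
  exact (ProbabilityTheory.integrable_cauchyPDFReal x).const_mul _

lemma integral_cauchyKernel (x : ℝ) {b : ℝ} (hb : 0 < b) :
    ∫ a : ℝ, b / ((a - x) ^ 2 + b ^ 2) = Real.pi := by
  lift b to NNReal using hb.le
  simp_rw [cauchyKernel_eq x _ hb]
  rw [integral_const_mul, ProbabilityTheory.integral_cauchyPDFReal_eq_one x
    (NNReal.coe_pos.1 hb).ne', mul_one]

lemma sub_mul_sub_conj (z : ℂ) (x : ℝ) :
    ((x : ℂ) - z) * (x - conj z) = (((x - z.re) ^ 2 + z.im ^ 2 : ℝ) : ℂ) := by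
  rw [show (x : ℂ) - conj z = conj ((x : ℂ) - z) by simp, Complex.mul_conj, Complex.normSq_apply]
  simp only [Complex.sub_re, Complex.sub_im, Complex.ofReal_re, Complex.ofReal_im]
  ring_nf

lemma div_sub_eq_add_dslope_add (F : ℂ → ℂ) (hz : 0 < z.im) (x : ℝ) :
    F x / (x - z) = F x / (x - conj z) + 2 * Complex.I * z.im * (dslope F z x / (x - conj z))
      + 2 * Complex.I * F z * ((z.im / ((x - z.re) ^ 2 + z.im ^ 2) : ℝ) : ℂ) := by
  have hne : (x : ℂ) - z ≠ 0 := sub_ne_zero.2 (ofReal_ne_of_im_pos hz x)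
  have hne' : (x : ℂ) - conj z ≠ 0 := sub_conj_ne_zero hz (by simp)
  have hsub : 2 * Complex.I * z.im = z - conj z := by rw [Complex.sub_conj]; push_cast; ring
  rw [dslope_of_ne _ (sub_ne_zero.1 hne), slope_def_field, Complex.ofReal_div, ← sub_mul_sub_conj,
    hsub, show 2 * Complex.I * F z * (z.im / (((x : ℂ) - z) * (x - conj z)))
      = (z - conj z) * F z / (((x : ℂ) - z) * (x - conj z)) by rw [← hsub]; ring]
  field_simp
  ring

lemma integral_div_sub_eq (hF : ContinuousOn F closedUpperHalfPlaneSet)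
    (hF' : DifferentiableOn ℂ F upperHalfPlaneSet)
    (hlim : Tendsto F (cobounded ℂ ⊓ 𝓟 closedUpperHalfPlaneSet) (𝓝 0)) (hz : 0 < z.im)
    (hint : Integrable fun x : ℝ => F x / (x - z)) :
    ∫ x : ℝ, F x / (x - z) = 2 * Complex.I * Real.pi * F z := by
  have hconj := integrable_div_sub_conj hz.ne' hint
  have hkernel : Integrable fun x : ℝ =>
      2 * Complex.I * F z * ((z.im / ((x - z.re) ^ 2 + z.im ^ 2) : ℝ) : ℂ) :=
    (integrable_cauchyKernel z.re hz).ofReal.const_mul _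
  have hslope : Integrable fun x : ℝ => dslope F z x / (x - conj z) := by
    have hne : 2 * Complex.I * (z.im : ℂ) ≠ 0 := by simp [hz.ne']
    refine (((hint.sub hconj).sub hkernel).const_mul (2 * Complex.I * (z.im : ℂ))⁻¹).congr
      (Eventually.of_forall fun x => ?_)
    simp only [Pi.sub_apply]
    rw [div_sub_eq_add_dslope_add F hz x, add_assoc, add_sub_cancel_left, add_sub_cancel_right,
      inv_mul_cancel_left₀ hne]
  have hsum : Integrable fun x : ℝ =>
      F x / (x - conj z) + 2 * Complex.I * z.im * (dslope F z x / (x - conj z)) :=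
    hconj.add (hslope.const_mul _)
  simp_rw [div_sub_eq_add_dslope_add F hz]
  rw [integral_add hsum hkernel,
    integral_add hconj (hslope.const_mul _), integral_div_sub_conj_eq_zero hF hF' hlim hz hint,
    integral_const_mul, integral_dslope_div_sub_conj_eq_zero hF hF' hlim hz hslope,
    integral_const_mul, integral_complex_ofReal, integral_cauchyKernel z.re hz]
  ring

lemma integral_im_div_sub_eq (hF : ContinuousOn F closedUpperHalfPlaneSet)
    (hF' : DifferentiableOn ℂ F upperHalfPlaneSet)
    (hlim : Tendsto F (cobounded ℂ ⊓ 𝓟 closedUpperHalfPlaneSet) (𝓝 0)) (hz : 0 < z.im)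
    (hint : Integrable fun x : ℝ => F x / (x - z)) :
    ∫ x : ℝ, ((F x).im : ℂ) / (x - z) = Real.pi * F z := by
  have hconj : ∀ x : ℝ, conj (F x) / (x - z) = conj (F x / (x - conj z)) := fun x => by simp
  have him : ∀ x : ℝ, ((F x).im : ℂ) / (x - z)
      = (2 * Complex.I)⁻¹ * (F x / (x - z) - conj (F x) / (x - z)) := fun x => by
    rw [← sub_div, Complex.sub_conj]
    push_cast
    field_simp
  have hint' : Integrable fun x : ℝ => conj (F x) / (x - z) := by
    simp_rw [hconj]
    exact Complex.conjLIE.toContinuousLinearEquiv.toContinuousLinearMap.integrable_comp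
      (integrable_div_sub_conj hz.ne' hint)
  simp_rw [him]
  rw [integral_const_mul, integral_sub hint hint', integral_div_sub_eq hF hF' hlim hz hint]
  simp_rw [hconj]
  rw [integral_conj, integral_div_sub_conj_eq_zero hF hF' hlim hz hint, map_zero]
  field_simp
  ring

end HalfPlaneCauchy

section PowerDecay

variable {m : ℂ → ℂ} {C s : ℝ} {z : ℂ}

/-- `m` is holomorphic in the upper half-plane, extends continuously to the real line minus the
origin, and is bounded by `C ‖w‖ ^ (-s)`. For `0 < s < 1` it is then recovered from its boundary
values, the singularity at the origin being integrable. -/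
structure HasPowerDecay (m : ℂ → ℂ) (C s : ℝ) : Prop where
  continuousOn : ContinuousOn m (closedUpperHalfPlaneSet \ {0})
  differentiableOn : DifferentiableOn ℂ m upperHalfPlaneSet
  norm_le : ∀ w : ℂ, 0 ≤ w.im → w ≠ 0 → ‖m w‖ ≤ C * ‖w‖ ^ (-s)

lemma exists_inv_norm_ofReal_sub_le (hz : z.im ≠ 0) :
    ∃ K : ℝ, ∀ x : ℝ, ‖(x : ℂ) - z‖⁻¹ ≤ K * (1 + |x|)⁻¹ := by
  have hy : 0 < |z.im| := abs_pos.2 hz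
  refine ⟨1 + (1 + ‖z‖) / |z.im|, fun x => ?_⟩
  have him : |z.im| ≤ ‖(x : ℂ) - z‖ := by
    simpa using Complex.abs_im_le_norm ((x : ℂ) - z)
  have htri : |x| ≤ ‖(x : ℂ) - z‖ + ‖z‖ := by
    simpa using norm_add_le ((x : ℂ) - z) z
  have hscale : 1 + ‖z‖ ≤ (1 + ‖z‖) / |z.im| * ‖(x : ℂ) - z‖ := by
    rw [div_mul_eq_mul_div, le_div_iff₀ hy]
    gcongr
  rw [inv_le_iff_one_le_mul₀ (hy.trans_le him), mul_right_comm, ← div_eq_mul_inv,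
    le_div_iff₀ (by positivity)]
  linarith

lemma integrable_abs_rpow_neg_mul_inv_one_add_abs (hs : 0 < s) (hs1 : s < 1) :
    Integrable fun x : ℝ => |x| ^ (-s) * (1 + |x|)⁻¹ := by
  suffices IntegrableOn (fun x : ℝ => x ^ (-s) * (1 + x)⁻¹) (Ioi 0) by
    simpa using (integrable_fun_norm_addHaar (volume : Measure ℝ)
      (f := fun x : ℝ => x ^ (-s) * (1 + x)⁻¹)).2 (by simpa using this)
  have hmeas : Measurable fun x : ℝ => x ^ (-s) * (1 + x)⁻¹ := by fun_prop
  rw [← Ioc_union_Ioi_eq_Ioi zero_le_one]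
  refine IntegrableOn.union ?_ ?_
  · have hint : IntegrableOn (fun x : ℝ => x ^ (-s)) (Ioc 0 1) :=
      (intervalIntegrable_iff_integrableOn_Ioc_of_le zero_le_one).1
        (intervalIntegral.intervalIntegrable_rpow' (by linarith))
    refine hint.mono' hmeas.aestronglyMeasurable
      (ae_restrict_of_forall_mem measurableSet_Ioc fun x hx => ?_)
    have hx0 : 0 < x := hx.1
    rw [Real.norm_of_nonneg (by positivity)]
    exact mul_le_of_le_one_right (by positivity) (inv_le_one_of_one_le₀ (by linarith))
  · refine (integrableOn_Ioi_rpow_of_lt (a := -s + -1) (by linarith) zero_lt_one).mono'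
      hmeas.aestronglyMeasurable (ae_restrict_of_forall_mem measurableSet_Ioi fun x hx => ?_)
    have hx0 : 0 < x := zero_lt_one.trans hx
    rw [Real.norm_of_nonneg (by positivity), Real.rpow_add hx0, Real.rpow_neg_one]
    gcongr
    linarith

lemma integrable_const_mul_abs_rpow_neg_mul_inv_norm (C : ℝ) (hs : 0 < s) (hs1 : s < 1)
    (hz : z.im ≠ 0) : Integrable fun x : ℝ => C * |x| ^ (-s) * ‖(x : ℂ) - z‖⁻¹ := by
  obtain ⟨K, hle⟩ := exists_inv_norm_ofReal_sub_le hz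
  refine ((integrable_abs_rpow_neg_mul_inv_one_add_abs hs hs1).const_mul (|C| * K)).mono'
    (Measurable.aestronglyMeasurable (by fun_prop)) (Eventually.of_forall fun x => ?_)
  have hpow : 0 ≤ |x| ^ (-s) := by positivity
  rw [norm_mul, norm_mul, Real.norm_eq_abs C, Real.norm_of_nonneg hpow, norm_inv, norm_norm]
  calc |C| * |x| ^ (-s) * ‖(x : ℂ) - z‖⁻¹ ≤ |C| * |x| ^ (-s) * (K * (1 + |x|)⁻¹) := by
        gcongr
        exact hle x
    _ = |C| * K * (|x| ^ (-s) * (1 + |x|)⁻¹) := by ring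

lemma norm_le_norm_add_ofReal_mul_I {ε : ℝ} (hε : 0 ≤ ε) (hz : 0 ≤ z.im) :
    ‖z‖ ≤ ‖z + ε * Complex.I‖ := by
  refine (sq_le_sq₀ (norm_nonneg _) (norm_nonneg _)).1 ?_
  rw [Complex.sq_norm, Complex.sq_norm, Complex.normSq_apply, Complex.normSq_apply]
  simp only [Complex.add_re, Complex.add_im, Complex.re_ofReal_mul, Complex.im_ofReal_mul,
    Complex.I_re, Complex.I_im, mul_zero, mul_one, add_zero]
  nlinarith [mul_nonneg hz hε]

lemma mapsTo_add_ofReal_mul_I {ε : ℝ} (hε : 0 < ε) :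
    MapsTo (fun w : ℂ => w + ε * Complex.I) closedUpperHalfPlaneSet upperHalfPlaneSet :=
  fun w hw => by simpa using add_pos_of_nonneg_of_pos hw hε

namespace HasPowerDecay

lemma const_nonneg (hm : HasPowerDecay m C s) : 0 ≤ C := by
  have h := hm.norm_le 1 (by simp) one_ne_zero
  rw [norm_one, Real.one_rpow, mul_one] at h
  exact (norm_nonneg _).trans h

lemma continuousOn_ofReal (hm : HasPowerDecay m C s) :
    ContinuousOn (fun x : ℝ => m x) {0}ᶜ :=
  hm.continuousOn.comp (by fun_prop) fun _ hx => ⟨by simp, by simpa using hx⟩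

lemma aestronglyMeasurable_ofReal (hm : HasPowerDecay m C s) :
    AEStronglyMeasurable fun x : ℝ => m x := by
  have h := hm.continuousOn_ofReal.aestronglyMeasurable (μ := volume)
    (measurableSet_singleton (0 : ℝ)).compl
  rwa [restrict_compl_singleton] at h

lemma integrable_div_sub (hm : HasPowerDecay m C s) (hs : 0 < s) (hs1 : s < 1)
    (hz : z.im ≠ 0) : Integrable fun x : ℝ => m x / (x - z) := by
  refine (integrable_const_mul_abs_rpow_neg_mul_inv_norm C hs hs1 hz).mono' ?_ ?_
  · simp_rw [div_eq_mul_inv]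
    exact hm.aestronglyMeasurable_ofReal.mul (Measurable.aestronglyMeasurable (by fun_prop))
  · filter_upwards [Measure.ae_ne volume (0 : ℝ)] with x hx
    have hle := hm.norm_le x (by simp) (Complex.ofReal_ne_zero.2 hx)
    rw [Complex.norm_real, Real.norm_eq_abs] at hle
    rw [norm_div, div_eq_mul_inv]
    gcongr

lemma tendsto_cobounded (hm : HasPowerDecay m C s) (hs : 0 < s) :
    Tendsto m (cobounded ℂ ⊓ 𝓟 closedUpperHalfPlaneSet) (𝓝 0) := by
  have hpow : Tendsto (fun w : ℂ => C * ‖w‖ ^ (-s))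
      (cobounded ℂ ⊓ 𝓟 closedUpperHalfPlaneSet) (𝓝 (C * 0)) :=
    (((tendsto_rpow_neg_atTop hs).comp tendsto_norm_cobounded_atTop).mono_left
      inf_le_left).const_mul C
  rw [mul_zero] at hpow
  refine squeeze_zero_norm' ?_ hpow
  rw [eventually_inf_principal]
  filter_upwards [eventually_ne_cobounded (0 : ℂ)] with w hw0 hw using hm.norm_le w hw hw0

lemma norm_add_ofReal_mul_I_le (hm : HasPowerDecay m C s) (hs : 0 ≤ s) {ε : ℝ} (hε : 0 < ε)
    {w : ℂ} (hw : 0 ≤ w.im) (hw0 : w ≠ 0) : ‖m (w + ε * Complex.I)‖ ≤ C * ‖w‖ ^ (-s) := by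
  have him : 0 < (w + ε * Complex.I).im := by simpa using add_pos_of_nonneg_of_pos hw hε
  refine (hm.norm_le _ him.le (ne_zero_of_im_pos him)).trans
    (mul_le_mul_of_nonneg_left ?_ hm.const_nonneg)
  exact Real.rpow_le_rpow_of_nonpos (norm_pos_iff.2 hw0)
    (norm_le_norm_add_ofReal_mul_I hε.le hw) (neg_nonpos.2 hs)

lemma continuousOn_add_ofReal_mul_I (hm : HasPowerDecay m C s) {ε : ℝ} (hε : 0 < ε) :
    ContinuousOn (fun w => m (w + ε * Complex.I)) closedUpperHalfPlaneSet :=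
  hm.differentiableOn.continuousOn.comp (by fun_prop) (mapsTo_add_ofReal_mul_I hε)

lemma add_ofReal_mul_I (hm : HasPowerDecay m C s) (hs : 0 ≤ s) {ε : ℝ} (hε : 0 < ε) :
    HasPowerDecay (fun w => m (w + ε * Complex.I)) C s where
  continuousOn := (hm.continuousOn_add_ofReal_mul_I hε).mono sdiff_subset
  differentiableOn := hm.differentiableOn.comp (by fun_prop) fun w hw =>
    mapsTo_add_ofReal_mul_I hε (show 0 ≤ w.im from le_of_lt hw)
  norm_le _ hw hw0 := hm.norm_add_ofReal_mul_I_le hs hε hw hw0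

lemma integral_im_add_ofReal_mul_I (hm : HasPowerDecay m C s) (hs : 0 < s) (hs1 : s < 1)
    (hz : 0 < z.im) {ε : ℝ} (hε : 0 < ε) :
    ∫ x : ℝ, ((m (x + ε * Complex.I)).im : ℂ) / (x - z) = Real.pi * m (z + ε * Complex.I) :=
  have hshift := hm.add_ofReal_mul_I hs.le hε
  integral_im_div_sub_eq (hm.continuousOn_add_ofReal_mul_I hε) hshift.differentiableOn
    (hshift.tendsto_cobounded hs) hz (hshift.integrable_div_sub hs hs1 hz.ne')

lemma tendsto_add_ofReal_mul_I (hm : HasPowerDecay m C s) {w : ℂ} (hw : 0 ≤ w.im) (hw0 : w ≠ 0) :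
    Tendsto (fun ε : ℝ => m (w + ε * Complex.I)) (𝓝[>] 0) (𝓝 (m w)) := by
  refine (hm.continuousOn w ⟨hw, hw0⟩).tendsto.comp (tendsto_nhdsWithin_iff.2 ⟨?_, ?_⟩)
  · have hcont : Continuous fun ε : ℝ => w + ε * Complex.I := by fun_prop
    simpa using (hcont.tendsto 0).mono_left nhdsWithin_le_nhds
  · filter_upwards [self_mem_nhdsWithin] with ε hε
    have him : 0 < (w + ε * Complex.I).im := mapsTo_add_ofReal_mul_I hε hw
    exact ⟨him.le, ne_zero_of_im_pos him⟩

theorem integral_im_div_sub (hm : HasPowerDecay m C s) (hs : 0 < s) (hs1 : s < 1)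
    (hz : 0 < z.im) : ∫ x : ℝ, ((m x).im : ℂ) / (x - z) = Real.pi * m z := by
  have hlim : Tendsto (fun ε : ℝ => ∫ x : ℝ, ((m (x + ε * Complex.I)).im : ℂ) / (x - z))
      (𝓝[>] 0) (𝓝 (∫ x : ℝ, ((m x).im : ℂ) / (x - z))) := by
    refine tendsto_integral_filter_of_dominated_convergence _ ?_ ?_
      (integrable_const_mul_abs_rpow_neg_mul_inv_norm C hs hs1 hz.ne') ?_
    · filter_upwards [self_mem_nhdsWithin] with ε hε
      have hmeas := (hm.add_ofReal_mul_I hs.le hε).aestronglyMeasurable_ofReal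
      simp_rw [div_eq_mul_inv]
      exact (Complex.continuous_ofReal.comp Complex.continuous_im).comp_aestronglyMeasurable hmeas
        |>.mul (Measurable.aestronglyMeasurable (by fun_prop))
    · filter_upwards [self_mem_nhdsWithin] with ε hε
      filter_upwards [Measure.ae_ne volume (0 : ℝ)] with x hx
      have hle := hm.norm_add_ofReal_mul_I_le hs.le hε (w := x) (by simp)
        (Complex.ofReal_ne_zero.2 hx)
      rw [Complex.norm_real, Real.norm_eq_abs] at hle
      rw [norm_div, div_eq_mul_inv, Complex.norm_real, Real.norm_eq_abs]
      gcongr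
      exact (Complex.abs_im_le_norm _).trans hle
    · filter_upwards [Measure.ae_ne volume (0 : ℝ)] with x hx
      have hx' := hm.tendsto_add_ofReal_mul_I (w := x) (by simp) (Complex.ofReal_ne_zero.2 hx)
      exact ((Complex.continuous_ofReal.comp Complex.continuous_im).tendsto _ |>.comp hx').div_const
        ((x : ℂ) - z)
  refine tendsto_nhds_unique (hlim.congr' ?_)
    ((hm.tendsto_add_ofReal_mul_I hz.le (ne_zero_of_im_pos hz)).const_mul _)
  filter_upwards [self_mem_nhdsWithin] with ε hε
  exact hm.integral_im_add_ofReal_mul_I hs hs1 hz hε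

end HasPowerDecay

end PowerDecay

section StieltjesTransform

variable {μ ν : Measure ℝ}

lemma integrable_inv_ofReal_sub (μ : Measure ℝ) [IsFiniteMeasure μ] {z : ℂ} (hz : 0 < z.im) :
    Integrable (fun x : ℝ => ((x : ℂ) - z)⁻¹) μ := by
  refine (integrable_const (z.im)⁻¹).mono' (Measurable.aestronglyMeasurable (by fun_prop))
    (Eventually.of_forall fun x => ?_)
  rw [norm_inv]
  refine inv_anti₀ hz ?_
  simpa [abs_of_pos hz] using Complex.abs_im_le_norm ((x : ℂ) - z)

lemma im_inv_ofReal_sub (a b x : ℝ) :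
    (((x : ℂ) - (a + b * Complex.I))⁻¹).im = b / ((a - x) ^ 2 + b ^ 2) := by
  rw [Complex.inv_im, Complex.normSq_apply]
  simp only [Complex.sub_re, Complex.sub_im, Complex.add_re, Complex.add_im, Complex.ofReal_re,
    Complex.ofReal_im, Complex.re_ofReal_mul, Complex.im_ofReal_mul, Complex.I_re, Complex.I_im]
  ring_nf

lemma im_integral_inv_ofReal_sub (μ : Measure ℝ) [IsFiniteMeasure μ] (a : ℝ) {b : ℝ} (hb : 0 < b) :
    (∫ x : ℝ, ((x : ℂ) - (a + b * Complex.I))⁻¹ ∂μ).im = ∫ x, b / ((a - x) ^ 2 + b ^ 2) ∂μ := by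
  have him := integral_im (integrable_inv_ofReal_sub μ (z := a + b * Complex.I) (by simpa using hb))
  simp only [RCLike.im_eq_complex_im, im_inv_ofReal_sub] at him
  exact him.symm

lemma integral_mul_cauchyKernel (f : ℝ → ℝ) (x : ℝ) {b : ℝ} (hb : 0 < b) :
    ∫ a, f a * (b / ((a - x) ^ 2 + b ^ 2)) = ∫ u, f (x + b * u) * (1 + u ^ 2)⁻¹ := by
  have hscale := Measure.integral_comp_mul_left
    (fun v : ℝ => f (x + v) * (b / (v ^ 2 + b ^ 2))) b
  have hshift := integral_add_left_eq_self (μ := volume)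
    (fun a : ℝ => f a * (b / ((a - x) ^ 2 + b ^ 2))) x
  simp only [add_sub_cancel_left] at hshift
  rw [hshift, smul_eq_mul, abs_of_pos (inv_pos.2 hb)] at hscale
  have hkernel : ∀ u : ℝ, f (x + b * u) * (b / ((b * u) ^ 2 + b ^ 2))
      = b⁻¹ * (f (x + b * u) * (1 + u ^ 2)⁻¹) := fun u => by
    have : 0 < (b * u) ^ 2 + b ^ 2 := by positivity
    have : 0 < 1 + u ^ 2 := by positivity
    field_simp
    ring
  simp_rw [hkernel] at hscale
  rw [integral_const_mul] at hscale
  exact (mul_left_cancel₀ (inv_ne_zero hb.ne') hscale).symm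

lemma integrable_mul_cauchyKernel (f : BoundedContinuousFunction ℝ ℝ) (x : ℝ) {b : ℝ}
    (hb : 0 < b) : Integrable fun a : ℝ => f a * (b / ((a - x) ^ 2 + b ^ 2)) :=
  (integrable_cauchyKernel x hb).bdd_mul (c := ‖f‖) f.continuous.aestronglyMeasurable
    (Eventually.of_forall fun a => f.norm_coe_le_norm a)

lemma integrable_prod_mul_cauchyKernel (μ : Measure ℝ) [IsFiniteMeasure μ]
    (f : BoundedContinuousFunction ℝ ℝ) {b : ℝ} (hb : 0 < b) :
    Integrable (Function.uncurry fun x a : ℝ => f a * (b / ((a - x) ^ 2 + b ^ 2)))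
      (μ.prod volume) := by
  have hmeas : AEStronglyMeasurable
      (Function.uncurry fun x a : ℝ => f a * (b / ((a - x) ^ 2 + b ^ 2))) (μ.prod volume) :=
    ((f.continuous.comp continuous_snd).mul (continuous_const.div (by fun_prop) fun p =>
      (by positivity : 0 < (p.2 - p.1) ^ 2 + b ^ 2).ne')).aestronglyMeasurable
  rw [integrable_prod_iff hmeas]
  refine ⟨Eventually.of_forall fun x => integrable_mul_cauchyKernel f x hb, ?_⟩
  refine (integrable_const (‖f‖ * Real.pi)).mono' hmeas.norm.integral_prod_right'
    (Eventually.of_forall fun x => ?_)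
  rw [Real.norm_of_nonneg (integral_nonneg fun a => norm_nonneg _), ← integral_cauchyKernel x hb,
    ← integral_const_mul]
  refine integral_mono (integrable_mul_cauchyKernel f x hb).norm
    ((integrable_cauchyKernel x hb).const_mul _) fun a => ?_
  simp only [Function.uncurry_apply_pair, norm_mul]
  rw [Real.norm_of_nonneg (by positivity : 0 ≤ b / ((a - x) ^ 2 + b ^ 2))]
  gcongr
  exact f.norm_coe_le_norm a

lemma integral_mul_integral_cauchyKernel (μ : Measure ℝ) [IsFiniteMeasure μ]
    (f : BoundedContinuousFunction ℝ ℝ) {b : ℝ} (hb : 0 < b) :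
    ∫ a, f a * ∫ x, b / ((a - x) ^ 2 + b ^ 2) ∂μ
      = ∫ x, (∫ u, f (x + b * u) * (1 + u ^ 2)⁻¹) ∂μ := by
  simp_rw [← integral_mul_cauchyKernel f _ hb]
  rw [integral_integral_swap (integrable_prod_mul_cauchyKernel μ f hb)]
  simp_rw [integral_const_mul]

lemma norm_mul_inv_one_add_sq_le (f : BoundedContinuousFunction ℝ ℝ) (y u : ℝ) :
    ‖f y * (1 + u ^ 2)⁻¹‖ ≤ ‖f‖ * (1 + u ^ 2)⁻¹ := by
  rw [norm_mul, Real.norm_of_nonneg (by positivity : 0 ≤ (1 + u ^ 2)⁻¹)]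
  gcongr
  exact f.norm_coe_le_norm y

lemma tendsto_integral_mul_inv_one_add_sq (f : BoundedContinuousFunction ℝ ℝ) (x : ℝ) :
    Tendsto (fun b : ℝ => ∫ u, f (x + b * u) * (1 + u ^ 2)⁻¹) (𝓝 0) (𝓝 (f x * Real.pi)) := by
  rw [← integral_univ_inv_one_add_sq, ← integral_const_mul]
  refine tendsto_integral_filter_of_dominated_convergence (fun u => ‖f‖ * (1 + u ^ 2)⁻¹)
    (Eventually.of_forall fun b => ?_)
    (Eventually.of_forall fun b => Eventually.of_forall fun u => norm_mul_inv_one_add_sq_le f _ u)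
    (integrable_inv_one_add_sq.const_mul _) (Eventually.of_forall fun u => Tendsto.mul_const _ ?_)
  · exact Measurable.aestronglyMeasurable
      ((f.continuous.measurable.comp (by fun_prop)).mul (by fun_prop))
  · have hcont : Continuous fun b : ℝ => f (x + b * u) := f.continuous.comp (by fun_prop)
    simpa using hcont.tendsto 0

lemma tendsto_integral_mul_integral_cauchyKernel (μ : Measure ℝ) [IsFiniteMeasure μ]
    (f : BoundedContinuousFunction ℝ ℝ) :
    Tendsto (fun b : ℝ => ∫ a, f a * ∫ x, b / ((a - x) ^ 2 + b ^ 2) ∂μ) (𝓝[>] 0)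
      (𝓝 ((∫ x, f x ∂μ) * Real.pi)) := by
  rw [← integral_mul_const]
  suffices Tendsto (fun b : ℝ => ∫ x, (∫ u, f (x + b * u) * (1 + u ^ 2)⁻¹) ∂μ) (𝓝[>] 0)
      (𝓝 (∫ x, f x * Real.pi ∂μ)) by
    refine this.congr' ?_
    filter_upwards [self_mem_nhdsWithin] with b hb
    exact (integral_mul_integral_cauchyKernel μ f hb).symm
  refine tendsto_integral_filter_of_dominated_convergence (μ := μ) (fun _ => ‖f‖ * Real.pi)
    (Eventually.of_forall fun b => ?_)
    (Eventually.of_forall fun b => Eventually.of_forall fun x => ?_)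
    (integrable_const _) (Eventually.of_forall fun x =>
      (tendsto_integral_mul_inv_one_add_sq f x).mono_left nhdsWithin_le_nhds)
  · have hcont : Continuous (Function.uncurry fun x u : ℝ => f (x + b * u) * (1 + u ^ 2)⁻¹) :=
      (f.continuous.comp (by fun_prop)).mul
        (Continuous.inv₀ (by fun_prop) fun p => (by positivity : 0 < 1 + p.2 ^ 2).ne')
    exact (hcont.stronglyMeasurable.integral_prod_right (ν := volume)).aestronglyMeasurable
  · rw [← integral_univ_inv_one_add_sq, ← integral_const_mul]
    exact norm_integral_le_of_norm_le (integrable_inv_one_add_sq.const_mul _)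
      (Eventually.of_forall fun u => norm_mul_inv_one_add_sq_le f _ u)

theorem eq_of_integral_inv_ofReal_sub_eq [IsFiniteMeasure μ] [IsFiniteMeasure ν]
    (h : ∀ z : ℂ, 0 < z.im → ∫ x : ℝ, ((x : ℂ) - z)⁻¹ ∂μ = ∫ x : ℝ, ((x : ℂ) - z)⁻¹ ∂ν) :
    μ = ν := by
  refine ext_of_forall_integral_eq_of_IsFiniteMeasure fun f => ?_
  refine mul_right_cancel₀ Real.pi_ne_zero (tendsto_nhds_unique
    (tendsto_integral_mul_integral_cauchyKernel μ f)
    ((tendsto_integral_mul_integral_cauchyKernel ν f).congr' ?_))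
  filter_upwards [self_mem_nhdsWithin] with b hb
  simp_rw [← im_integral_inv_ofReal_sub _ _ hb]
  congr! 4 with a
  exact (h _ (by simpa using hb)).symm

lemma re_neg_mul_inv_ofReal_sub (x y : ℝ) :
    (-(y * Complex.I) * ((x : ℂ) - y * Complex.I)⁻¹).re = y ^ 2 / (x ^ 2 + y ^ 2) := by
  rw [Complex.mul_re, Complex.inv_re, Complex.inv_im, Complex.normSq_apply]
  simp only [Complex.sub_re, Complex.sub_im, Complex.neg_re, Complex.neg_im, Complex.ofReal_re,
    Complex.ofReal_im, Complex.re_ofReal_mul, Complex.im_ofReal_mul, Complex.I_re, Complex.I_im]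
  ring

lemma tendsto_lintegral_sq_div_sq_add_sq (μ : Measure ℝ) :
    Tendsto (fun n : ℕ => ∫⁻ x, ENNReal.ofReal (((n : ℝ) + 1) ^ 2 / (x ^ 2 + ((n : ℝ) + 1) ^ 2)) ∂μ)
      atTop (𝓝 (μ univ)) := by
  rw [← lintegral_one]
  refine lintegral_tendsto_of_tendsto_of_monotone (fun n => Measurable.aemeasurable (by fun_prop))
    (Eventually.of_forall fun x n k hnk => ENNReal.ofReal_le_ofReal ?_)
    (Eventually.of_forall fun x => ?_)
  · have hsq : ((n : ℝ) + 1) ^ 2 ≤ ((k : ℝ) + 1) ^ 2 := by gcongr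
    rw [div_le_div_iff₀ (by positivity) (by positivity)]
    nlinarith [sq_nonneg x]
  · have hsq : Tendsto (fun n : ℕ => ((n : ℝ) + 1) ^ 2) atTop atTop :=
      (tendsto_pow_atTop two_ne_zero).comp
        (tendsto_atTop_add_const_right _ _ tendsto_natCast_atTop_atTop)
    have hlim := (tendsto_const_nhds (x := x ^ 2)).div_atTop
      (tendsto_atTop_add_const_left _ (x ^ 2) hsq) |>.const_sub 1
    rw [← ENNReal.ofReal_one, ← sub_zero (1 : ℝ)]
    refine ENNReal.tendsto_ofReal (hlim.congr fun n => ?_)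
    have : 0 < x ^ 2 + ((n : ℝ) + 1) ^ 2 := by positivity
    field_simp
    ring

theorem isProbabilityMeasure_of_tendsto_neg_mul_integral
    (hint : ∀ y : ℝ, 0 < y → Integrable (fun x : ℝ => ((x : ℂ) - y * Complex.I)⁻¹) μ)
    (hlim : Tendsto (fun y : ℝ => -(y * Complex.I) * ∫ x : ℝ, ((x : ℂ) - y * Complex.I)⁻¹ ∂μ)
      atTop (𝓝 1)) : IsProbabilityMeasure μ := by
  have hre : ∀ y : ℝ, 0 < y →
      ENNReal.ofReal (-(y * Complex.I) * ∫ x : ℝ, ((x : ℂ) - y * Complex.I)⁻¹ ∂μ).re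
        = ∫⁻ x, ENNReal.ofReal (y ^ 2 / (x ^ 2 + y ^ 2)) ∂μ := fun y hy => by
    have hmul := (hint y hy).const_mul (-(y * Complex.I))
    have hval := integral_re hmul
    have hmul_re := hmul.re
    simp only [RCLike.re_eq_complex_re, re_neg_mul_inv_ofReal_sub] at hval hmul_re
    rw [← integral_const_mul, ← hval, ofReal_integral_eq_lintegral_ofReal hmul_re
      (Eventually.of_forall fun x => by positivity)]
  have hnat : Tendsto (fun n : ℕ => (n : ℝ) + 1) atTop atTop :=
    tendsto_atTop_add_const_right _ _ tendsto_natCast_atTop_atTop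
  have hone := ENNReal.tendsto_ofReal ((Complex.continuous_re.tendsto 1).comp (hlim.comp hnat))
  rw [Complex.one_re, ENNReal.ofReal_one] at hone
  refine ⟨tendsto_nhds_unique (tendsto_lintegral_sq_div_sq_add_sq μ) (hone.congr fun n => ?_)⟩
  exact_mod_cast hre ((n : ℝ) + 1) (by positivity)

end StieltjesTransform

section BoundaryMeasure

variable {m : ℂ → ℂ} {C s : ℝ} {z : ℂ}

/-- The density `Im m / π` on the real line of the measure whose Stieltjes transform is `m`. -/
def boundaryDensity (m : ℂ → ℂ) (x : ℝ) : ℝ := (m x).im / Real.pi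

/-- The measure on `(0, ∞)` with density `boundaryDensity m`. -/
def boundaryMeasure (m : ℂ → ℂ) : Measure ℝ :=
  (volume.restrict (Ioi 0)).withDensity fun x => ENNReal.ofReal (boundaryDensity m x)

lemma boundaryMeasure_Iio_zero (m : ℂ → ℂ) : boundaryMeasure m (Iio 0) = 0 := by
  refine withDensity_absolutelyContinuous _ _ ?_
  rw [Measure.restrict_apply measurableSet_Iio, Iio_inter_Ioi, Ioo_self, measure_empty]

namespace HasPowerDecay

lemma continuousOn_boundaryDensity (hm : HasPowerDecay m C s) :
    ContinuousOn (boundaryDensity m) (Ioi 0) :=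
  (Complex.continuous_im.comp_continuousOn
    (hm.continuousOn_ofReal.mono fun _ hx => (ne_of_gt hx : _ ≠ (0 : ℝ)))).div_const _

lemma aemeasurable_ofReal_boundaryDensity (hm : HasPowerDecay m C s) :
    AEMeasurable (fun x => ENNReal.ofReal (boundaryDensity m x)) (volume.restrict (Ioi 0)) :=
  (hm.continuousOn_boundaryDensity.aemeasurable measurableSet_Ioi).ennreal_ofReal

lemma integrable_im_div_sub (hm : HasPowerDecay m C s) (hs : 0 < s) (hs1 : s < 1)
    (hz : z.im ≠ 0) : Integrable fun x : ℝ => ((m x).im : ℂ) / (x - z) := by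
  refine (hm.integrable_div_sub hs hs1 hz).mono ?_ (Eventually.of_forall fun x => ?_)
  · simp_rw [div_eq_mul_inv]
    exact (Complex.continuous_ofReal.comp_aestronglyMeasurable
      (Complex.continuous_im.comp_aestronglyMeasurable hm.aestronglyMeasurable_ofReal)).mul
      (Measurable.aestronglyMeasurable (by fun_prop))
  · rw [norm_div, norm_div, Complex.norm_real]
    gcongr
    exact Complex.abs_im_le_norm _

lemma toReal_smul_inv_sub_eq (hpos : ∀ x : ℝ, 0 < x → 0 ≤ (m x).im) {x : ℝ} (hx : 0 < x) (z : ℂ) :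
    (ENNReal.ofReal (boundaryDensity m x)).toReal • ((x : ℂ) - z)⁻¹
      = (Real.pi : ℂ)⁻¹ * (((m x).im : ℂ) / (x - z)) := by
  rw [boundaryDensity, ENNReal.toReal_ofReal (div_nonneg (hpos x hx) Real.pi_pos.le),
    Complex.real_smul]
  push_cast
  ring

lemma integrable_inv_sub_boundaryMeasure (hm : HasPowerDecay m C s) (hs : 0 < s) (hs1 : s < 1)
    (hpos : ∀ x : ℝ, 0 < x → 0 ≤ (m x).im) (hz : z.im ≠ 0) :
    Integrable (fun x : ℝ => ((x : ℂ) - z)⁻¹) (boundaryMeasure m) := by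
  rw [boundaryMeasure, integrable_withDensity_iff_integrable_smul₀'
    hm.aemeasurable_ofReal_boundaryDensity (Eventually.of_forall fun _ => ENNReal.ofReal_lt_top)]
  exact IntegrableOn.congr_fun ((hm.integrable_im_div_sub hs hs1 hz).integrableOn.const_mul _)
    (fun x hx => (toReal_smul_inv_sub_eq hpos hx z).symm) measurableSet_Ioi

theorem integral_inv_sub_boundaryMeasure (hm : HasPowerDecay m C s) (hs : 0 < s) (hs1 : s < 1)
    (hneg : ∀ x : ℝ, x < 0 → (m x).im = 0) (hpos : ∀ x : ℝ, 0 < x → 0 ≤ (m x).im)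
    (hz : 0 < z.im) : ∫ x : ℝ, ((x : ℂ) - z)⁻¹ ∂boundaryMeasure m = m z := by
  rw [boundaryMeasure, integral_withDensity_eq_integral_toReal_smul₀
    hm.aemeasurable_ofReal_boundaryDensity (Eventually.of_forall fun _ => ENNReal.ofReal_lt_top),
    setIntegral_congr_fun measurableSet_Ioi fun x hx => toReal_smul_inv_sub_eq hpos hx z,
    integral_const_mul, setIntegral_eq_integral_of_ae_compl_eq_zero,
    hm.integral_im_div_sub hs hs1 hz,
    inv_mul_cancel_left₀ (Complex.ofReal_ne_zero.2 Real.pi_ne_zero)]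
  filter_upwards [Measure.ae_ne volume (0 : ℝ)] with x hx hx'
  rw [hneg x (lt_of_le_of_ne (not_lt.1 hx') hx), Complex.ofReal_zero, zero_div]

theorem isProbabilityMeasure_boundaryMeasure (hm : HasPowerDecay m C s) (hs : 0 < s) (hs1 : s < 1)
    (hneg : ∀ x : ℝ, x < 0 → (m x).im = 0) (hpos : ∀ x : ℝ, 0 < x → 0 ≤ (m x).im)
    (hlim : Tendsto (fun y : ℝ => -(y * Complex.I) * m (y * Complex.I)) atTop (𝓝 1)) :
    IsProbabilityMeasure (boundaryMeasure m) := by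
  refine isProbabilityMeasure_of_tendsto_neg_mul_integral
    (fun y hy => hm.integrable_inv_sub_boundaryMeasure hs hs1 hpos (by simpa using hy.ne'))
    (hlim.congr' ?_)
  filter_upwards [eventually_gt_atTop 0] with y hy
  rw [hm.integral_inv_sub_boundaryMeasure hs hs1 hneg hpos (by simpa using hy)]

end HasPowerDecay

end BoundaryMeasure

section CanonicalTransform

variable {ι : Type*} [Fintype ι] {r : ι → ℝ} {c : ℝ} {p z : ℂ}

/-- The average of `1 / (rᵢ - p)`, the normalized trace of the resolvent at `p`. -/
def resolventMean (r : ι → ℝ) (p : ℂ) : ℂ := 𝔼 i, ((r i : ℂ) - p)⁻¹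

lemma differentiableAt_expect_div_sub (a : ι → ℂ) (hp : ∀ i, (r i : ℂ) ≠ p) :
    DifferentiableAt ℂ (fun w => 𝔼 i, a i / (r i - w)) p := by
  simp only [Fintype.expect_eq_sum_div_card]
  refine (DifferentiableAt.fun_sum fun i _ => ?_).div_const _
  exact (differentiableAt_const _).div (by fun_prop) (sub_ne_zero.2 (hp i))

lemma differentiableAt_ratioMean (hp : ∀ i, (r i : ℂ) ≠ p) : DifferentiableAt ℂ (ratioMean r) p :=
  differentiableAt_expect_div_sub _ hp

lemma continuousAt_resolventMean (hp : ∀ i, (r i : ℂ) ≠ p) : ContinuousAt (resolventMean r) p := by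
  unfold resolventMean
  simpa only [one_div] using (differentiableAt_expect_div_sub (fun _ => 1) hp).continuousAt

/-- The continuous extension of `canonicalInv c r` to the closed upper half-plane. -/
def canonicalInvExt (c : ℝ) (r : ι → ℝ) : ℂ → ℂ :=
  extendFrom upperHalfPlaneSet (canonicalInv c r)

/-- The function `(1/M) Tr T(z)` written in terms of the eigenvalues of `R`, continued to the
closed upper half-plane minus the origin. -/
def canonicalTransform (c : ℝ) (r : ι → ℝ) (z : ℂ) : ℂ :=
  (ratioMean r (canonicalInvExt c r z) - 1) / z

lemma im_canonicalTransform_ofReal (c : ℝ) (r : ι → ℝ) (x : ℝ) :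
    (canonicalTransform c r x).im = (ratioMean r (canonicalInvExt c r x)).im / x := by
  rw [canonicalTransform, Complex.div_ofReal_im, Complex.sub_im, Complex.one_im, sub_zero]

variable [Nonempty ι]

lemma ratioMean_eq_one_add (hp : ∀ i, (r i : ℂ) ≠ p) :
    ratioMean r p = 1 + p * resolventMean r p := by
  rw [ratioMean, resolventMean, Finset.mul_expect,
    ← Finset.expect_const (Finset.univ_nonempty (α := ι)) (1 : ℂ), ← Finset.expect_add_distrib]
  refine Finset.expect_congr rfl fun i _ => ?_
  have hne := sub_ne_zero.2 (hp i)
  field_simp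
  ring

lemma closedUpperHalfPlaneSet_subset_closure :
    closedUpperHalfPlaneSet ⊆ closure upperHalfPlaneSet := by
  rw [Complex.closure_setOfPred_lt_im]

lemma canonicalInvExt_spec (hr : ∀ i, 0 < r i) (hc : 0 < c) (hz : 0 ≤ z.im) :
    ((∀ i, (r i : ℂ) ≠ canonicalInvExt c r z) ∧ canonicalMap c r (canonicalInvExt c r z) = z) ∧
      Tendsto (canonicalInv c r) (𝓝[upperHalfPlaneSet] z) (𝓝 (canonicalInvExt c r z)) := by
  obtain ⟨p, hp, hlim⟩ : ∃ p, ((∀ i, (r i : ℂ) ≠ p) ∧ canonicalMap c r p = z) ∧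
      Tendsto (canonicalInv c r) (𝓝[upperHalfPlaneSet] z) (𝓝 p) := by
    rcases hz.eq_or_lt with him | him
    · lift z to ℝ using him.symm
      exact exists_tendsto_canonicalInv hr hc z
    · exact ⟨canonicalInv c r z, ⟨ne_of_mem_canonicalDomain (canonicalInv_mem hr hc him),
        canonicalMap_canonicalInv hr hc him⟩, continuousOn_canonicalInv hr hc z him⟩
  rw [canonicalInvExt, extendFrom_eq (closedUpperHalfPlaneSet_subset_closure hz) hlim]
  exact ⟨hp, hlim⟩

lemma ne_canonicalInvExt (hr : ∀ i, 0 < r i) (hc : 0 < c) (hz : 0 ≤ z.im) (i : ι) :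
    (r i : ℂ) ≠ canonicalInvExt c r z :=
  (canonicalInvExt_spec hr hc hz).1.1 i

lemma canonicalMap_canonicalInvExt (hr : ∀ i, 0 < r i) (hc : 0 < c) (hz : 0 ≤ z.im) :
    canonicalMap c r (canonicalInvExt c r z) = z :=
  (canonicalInvExt_spec hr hc hz).1.2

lemma canonicalInvExt_eq (hr : ∀ i, 0 < r i) (hc : 0 < c) (hz : 0 < z.im) :
    canonicalInvExt c r z = canonicalInv c r z :=
  extendFrom_extends (continuousOn_canonicalInv hr hc) z hz

lemma continuousOn_canonicalInvExt (hr : ∀ i, 0 < r i) (hc : 0 < c) :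
    ContinuousOn (canonicalInvExt c r) closedUpperHalfPlaneSet :=
  continuousOn_extendFrom closedUpperHalfPlaneSet_subset_closure fun _ hz =>
    ⟨_, (canonicalInvExt_spec hr hc hz).2⟩

lemma tendsto_canonicalInvExt_zero (hr : ∀ i, 0 < r i) (hc : 0 < c) (hc1 : c ≤ 1) :
    Tendsto (canonicalInvExt c r) (𝓝[closedUpperHalfPlaneSet] 0) (𝓝 0) := by
  have h := (continuousOn_canonicalInvExt (r := r) hr hc 0 (by simp)).tendsto
  rwa [show canonicalInvExt c r 0 = 0 from extendFrom_eq
    (closedUpperHalfPlaneSet_subset_closure (by simp)) (tendsto_canonicalInv_zero hr hc hc1)] at h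

lemma im_canonicalInvExt_nonneg (hr : ∀ i, 0 < r i) (hc : 0 < c) (hz : 0 ≤ z.im) :
    0 ≤ (canonicalInvExt c r z).im := by
  have := nhdsWithin_upperHalfPlaneSet_neBot hz
  refine ge_of_tendsto ((Complex.continuous_im.tendsto _).comp (canonicalInvExt_spec hr hc hz).2) ?_
  filter_upwards [self_mem_nhdsWithin] with w hw using (canonicalInv_mem hr hc hw).1.le

lemma im_canonicalInvExt_ofReal_of_neg (hr : ∀ i, 0 < r i) (hc : 0 < c) {x : ℝ} (hx : x < 0) :
    (canonicalInvExt c r x).im = 0 := by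
  obtain ⟨⟨hp, -⟩, hlim⟩ := canonicalInvExt_spec (z := x) hr hc (by simp)
  have := nhdsWithin_upperHalfPlaneSet_neBot (z := x) (by simp)
  have hdiv : 0 ≤ (transfer r (canonicalInvExt c r x) / x).im := by
    refine ge_of_tendsto ((Complex.continuous_im.tendsto _).comp
      (((hasStrictDerivAt_transfer hp).hasDerivAt.continuousAt.tendsto.comp hlim).div
        (tendsto_id.mono_left nhdsWithin_le_nhds) (Complex.ofReal_ne_zero.2 hx.ne))) ?_
    filter_upwards [self_mem_nhdsWithin] with z hz
    exact (im_transfer_canonicalInv_div_pos hr hc hz).le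
  rw [Complex.div_ofReal_im, im_transfer] at hdiv
  refine le_antisymm (not_lt.1 fun him => hdiv.not_gt ?_)
    (im_canonicalInvExt_nonneg hr hc (by simp))
  exact div_neg_of_pos_of_neg (mul_pos (transferEnergy_pos hr hp) him) hx

lemma norm_ratioMean_canonicalInvExt_le (hr : ∀ i, 0 < r i) (hc : 0 < c) (hz : 0 ≤ z.im) :
    ‖ratioMean r (canonicalInvExt c r z)‖ ≤ √c⁻¹ := by
  have := nhdsWithin_upperHalfPlaneSet_neBot hz
  obtain ⟨⟨hp, -⟩, hlim⟩ := canonicalInvExt_spec hr hc hz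
  refine le_of_tendsto ((differentiableAt_ratioMean hp).continuousAt.tendsto.comp hlim).norm ?_
  filter_upwards [self_mem_nhdsWithin] with w hw
  exact Real.le_sqrt_of_sq_le (norm_ratioMean_sq_lt_inv hr hc (canonicalInv_mem hr hc hw)).le

lemma canonicalTransform_eq (hr : ∀ i, 0 < r i) (hc : 0 < c) (hz : 0 ≤ z.im) :
    canonicalTransform c r z
      = canonicalInvExt c r z * resolventMean r (canonicalInvExt c r z) / z := by
  rw [canonicalTransform, ratioMean_eq_one_add (ne_canonicalInvExt hr hc hz), add_sub_cancel_left]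

lemma continuousOn_canonicalTransform (hr : ∀ i, 0 < r i) (hc : 0 < c) :
    ContinuousOn (canonicalTransform c r) (closedUpperHalfPlaneSet \ {0}) := by
  refine ContinuousOn.div (ContinuousOn.sub (fun z hz => ?_) continuousOn_const) continuousOn_id
    fun z hz => hz.2
  exact (differentiableAt_ratioMean (ne_canonicalInvExt hr hc hz.1)).continuousAt
    |>.comp_continuousWithinAt ((continuousOn_canonicalInvExt hr hc).mono sdiff_subset z hz)

lemma differentiableOn_canonicalTransform (hr : ∀ i, 0 < r i) (hc : 0 < c) :
    DifferentiableOn ℂ (canonicalTransform c r) upperHalfPlaneSet := by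
  have hdiff : DifferentiableOn ℂ (fun z => (ratioMean r (canonicalInv c r z) - 1) / z)
      upperHalfPlaneSet := fun z hz => by
    have hk := (differentiableAt_ratioMean (ne_of_mem_canonicalDomain
      (canonicalInv_mem hr hc hz))).comp z (differentiableAt_canonicalInv hr hc hz)
    exact ((hk.sub_const 1).div differentiableAt_id
      (ne_zero_of_im_pos hz)).differentiableWithinAt
  exact hdiff.congr fun z hz => by rw [canonicalTransform, canonicalInvExt_eq hr hc hz]

lemma im_canonicalTransform_ofReal_of_neg (hr : ∀ i, 0 < r i) (hc : 0 < c) {x : ℝ} (hx : x < 0) :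
    (canonicalTransform c r x).im = 0 := by
  rw [im_canonicalTransform_ofReal, im_ratioMean, im_canonicalInvExt_ofReal_of_neg hr hc hx,
    mul_zero, zero_div]

lemma im_canonicalTransform_ofReal_nonneg (hr : ∀ i, 0 < r i) (hc : 0 < c) {x : ℝ} (hx : 0 < x) :
    0 ≤ (canonicalTransform c r x).im := by
  rw [im_canonicalTransform_ofReal, im_ratioMean]
  exact div_nonneg (mul_nonneg (Finset.expect_nonneg fun i _ => div_nonneg (hr i).le (sq_nonneg _))
    (im_canonicalInvExt_nonneg hr hc (by simp))) hx.le

lemma tendsto_neg_mul_canonicalTransform (hr : ∀ i, 0 < r i) (hc : 0 < c) :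
    Tendsto (fun y : ℝ => -(y * Complex.I) * canonicalTransform c r (y * Complex.I)) atTop
      (𝓝 1) := by
  have hI : Tendsto (fun y : ℝ => (y : ℂ) * Complex.I) atTop
      (cobounded ℂ ⊓ 𝓟 upperHalfPlaneSet) := by
    refine tendsto_inf.2 ⟨?_, tendsto_principal.2 ?_⟩
    · rw [← tendsto_norm_atTop_iff_cobounded]
      simpa using tendsto_abs_atTop_atTop
    · filter_upwards [eventually_gt_atTop 0] with y hy
      simpa using hy
  have hk := ((tendsto_ratioMean_cobounded r).comp
    ((tendsto_canonicalInv_cobounded hr hc).comp hI)).const_sub 1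
  rw [sub_zero] at hk
  refine hk.congr' ?_
  filter_upwards [eventually_gt_atTop 0] with y hy
  have him : 0 < ((y : ℂ) * Complex.I).im := by simpa using hy
  rw [canonicalTransform, canonicalInvExt_eq hr hc him, neg_mul,
    mul_div_cancel₀ _ (ne_zero_of_im_pos him), neg_sub]
  rfl

end CanonicalTransform

section NearZero

variable {ι : Type*} [Fintype ι] {r : ι → ℝ} {c : ℝ}

/-- The average of `1 / rᵢ`, which is `(1/M) Tr R⁻¹` when the `rᵢ` are the eigenvalues of `R`. -/
def invMean (r : ι → ℝ) : ℝ := 𝔼 i, (r i)⁻¹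

lemma tendsto_resolventMean_zero (hr : ∀ i, 0 < r i) :
    Tendsto (resolventMean r) (𝓝 0) (𝓝 (invMean r)) := by
  have h := (continuousAt_resolventMean (r := r) (p := 0)
    fun i => Complex.ofReal_ne_zero.2 (hr i).ne').tendsto
  simpa [resolventMean, invMean, Fintype.expect_eq_sum_div_card] using h

variable [Nonempty ι]

lemma invMean_pos (hr : ∀ i, 0 < r i) : 0 < invMean r :=
  Finset.expect_pos (fun i _ => inv_pos.2 (hr i)) Finset.univ_nonempty

lemma tendsto_ratioMean_zero (hr : ∀ i, 0 < r i) : Tendsto (ratioMean r) (𝓝 0) (𝓝 1) := by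
  have hne : ∀ i, (r i : ℂ) ≠ 0 := fun i => Complex.ofReal_ne_zero.2 (hr i).ne'
  have h := (differentiableAt_ratioMean hne).continuousAt.tendsto
  rwa [ratioMean_eq_one_add hne, zero_mul, add_zero] at h

lemma tendsto_canonicalInvExt_nhdsNE_zero (hr : ∀ i, 0 < r i) (hc : 0 < c) (hc1 : c ≤ 1) :
    Tendsto (canonicalInvExt c r) (𝓝[closedUpperHalfPlaneSet \ {0}] 0) (𝓝 0) :=
  (tendsto_canonicalInvExt_zero hr hc hc1).mono_left (nhdsWithin_mono _ sdiff_subset)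

lemma tendsto_canonicalTransform_pow_mul_pow (hr : ∀ i, 0 < r i) (hc : 0 < c) (hc1 : c ≤ 1)
    {A : ℂ → ℂ} {a : ℂ} {n : ℕ} (ha : a ≠ 0) (hA : Tendsto A (𝓝 0) (𝓝 a))
    (hmap : ∀ p, (∀ i, (r i : ℂ) ≠ p) → canonicalMap c r p = p ^ (n + 1) * A p) :
    Tendsto (fun z => canonicalTransform c r z ^ (n + 1) * z ^ n)
      (𝓝[closedUpperHalfPlaneSet \ {0}] 0) (𝓝 (invMean r ^ (n + 1) / a)) := by
  have hext := tendsto_canonicalInvExt_nhdsNE_zero hr hc hc1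
  refine ((((tendsto_resolventMean_zero hr).comp hext).pow (n + 1)).div
    (hA.comp hext) ha).congr' ?_
  filter_upwards [self_mem_nhdsWithin] with z ⟨hz, hz0⟩
  have hz_eq := canonicalMap_canonicalInvExt hr hc hz
  rw [hmap _ (ne_canonicalInvExt hr hc hz)] at hz_eq
  have hA0 : A (canonicalInvExt c r z) ≠ 0 := fun h => hz0 (by rw [← hz_eq, h, mul_zero]; rfl)
  rw [canonicalTransform_eq hr hc hz, div_pow, mul_pow, pow_succ' z, div_mul_eq_mul_div,
    mul_div_mul_right _ _ (pow_ne_zero n hz0)]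
  refine (div_eq_div_iff hA0 hz0).2 ?_
  simp only [Function.comp_apply]
  linear_combination -resolventMean r (canonicalInvExt c r z) ^ (n + 1) * hz_eq

lemma tendsto_canonicalTransform_sq_mul (hr : ∀ i, 0 < r i) (hc : 0 < c) (hc1 : c < 1) :
    Tendsto (fun z => canonicalTransform c r z ^ 2 * z)
      (𝓝[closedUpperHalfPlaneSet \ {0}] 0) (𝓝 (-(invMean r ^ 2 / (c * (1 - c)) : ℝ))) := by
  have hpos : 0 < c * (1 - c) := mul_pos hc (by linarith)
  have hA : Tendsto (fun p => -c * ratioMean r p * (1 - c * ratioMean r p)) (𝓝 0)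
      (𝓝 (-(c * (1 - c) : ℝ))) := by
    have hk := tendsto_ratioMean_zero hr
    convert (hk.const_mul (-c : ℂ)).mul ((hk.const_mul (c : ℂ)).const_sub 1) using 2
    push_cast
    ring
  have h := tendsto_canonicalTransform_pow_mul_pow (n := 1) hr hc hc1.le
    (neg_ne_zero.2 (Complex.ofReal_ne_zero.2 hpos.ne')) hA
    fun p _ => by rw [canonicalMap_eq]; ring
  simpa [div_neg] using h

lemma tendsto_canonicalTransform_one_pow_three_mul (hr : ∀ i, 0 < r i) :
    Tendsto (fun z => canonicalTransform 1 r z ^ 3 * z ^ 2)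
      (𝓝[closedUpperHalfPlaneSet \ {0}] 0) (𝓝 (invMean r ^ 2 : ℝ)) := by
  have hpos := invMean_pos hr
  have h := tendsto_canonicalTransform_pow_mul_pow (n := 2) hr one_pos le_rfl
    (by simpa using hpos.ne')
    ((tendsto_ratioMean_zero hr).mul (tendsto_resolventMean_zero hr)) fun p hp => by
      rw [canonicalMap_eq]
      nth_rw 2 [ratioMean_eq_one_add hp]
      push_cast
      ring
  rw [one_mul, pow_succ, mul_div_cancel_right₀ _ (Complex.ofReal_ne_zero.2 hpos.ne')] at h
  simpa using h

lemma tendsto_mul_canonicalTransform_zero (hr : ∀ i, 0 < r i) (hc : 0 < c) (hc1 : c ≤ 1) :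
    Tendsto (fun z => canonicalTransform c r z * z)
      (𝓝[closedUpperHalfPlaneSet \ {0}] 0) (𝓝 0) := by
  have h := ((tendsto_ratioMean_zero hr).comp
    (tendsto_canonicalInvExt_nhdsNE_zero hr hc hc1)).sub_const 1
  rw [sub_self] at h
  refine h.congr' ?_
  filter_upwards [self_mem_nhdsWithin] with z hz
  rw [canonicalTransform, div_mul_cancel₀ _ hz.2, Function.comp_apply]

lemma exists_tendsto_canonicalTransform_pow_three_mul (hr : ∀ i, 0 < r i) (hc : 0 < c)
    (hc1 : c ≤ 1) :
    ∃ a, Tendsto (fun z => canonicalTransform c r z ^ 3 * z ^ 2)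
      (𝓝[closedUpperHalfPlaneSet \ {0}] 0) (𝓝 a) := by
  rcases hc1.lt_or_eq with hlt | rfl
  · refine ⟨_, ((tendsto_canonicalTransform_sq_mul hr hc hlt).mul
      (tendsto_mul_canonicalTransform_zero hr hc hc1)).congr fun z => ?_⟩
    ring
  · exact ⟨_, tendsto_canonicalTransform_one_pow_three_mul hr⟩

lemma exists_norm_canonicalTransform_mul_norm_le (hr : ∀ i, 0 < r i) (hc : 0 < c) :
    ∃ B, ∀ z : ℂ, 0 ≤ z.im → z ≠ 0 → ‖canonicalTransform c r z‖ * ‖z‖ ≤ B := by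
  refine ⟨√c⁻¹ + ‖(1 : ℂ)‖, fun z hz hz0 => ?_⟩
  rw [canonicalTransform, norm_div, div_mul_cancel₀ _ (norm_ne_zero_iff.2 hz0)]
  exact (norm_sub_le _ _).trans (by gcongr; exact norm_ratioMean_canonicalInvExt_le hr hc hz)

lemma exists_norm_canonicalTransform_pow_three_mul_le (hr : ∀ i, 0 < r i) (hc : 0 < c)
    (hc1 : c ≤ 1) :
    ∃ K, ∀ z : ℂ, 0 ≤ z.im → z ≠ 0 → ‖canonicalTransform c r z‖ ^ 3 * ‖z‖ ^ 2 ≤ K := by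
  obtain ⟨a, ha⟩ := exists_tendsto_canonicalTransform_pow_three_mul hr hc hc1
  obtain ⟨B, hB⟩ := exists_norm_canonicalTransform_mul_norm_le hr hc
  obtain ⟨δ, hδ, hnear⟩ := Metric.mem_nhdsWithin_iff.1
    (ha.norm.eventually (gt_mem_nhds (lt_add_one ‖a‖)))
  refine ⟨max (‖a‖ + 1) (B ^ 3 / δ), fun z hz hz0 => ?_⟩
  rcases lt_or_ge ‖z‖ δ with hlt | hge
  · rw [← norm_pow, ← norm_pow, ← norm_mul]
    exact (hnear ⟨mem_ball_zero_iff.2 hlt, hz, hz0⟩).le.trans (le_max_left _ _)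
  · refine le_trans ?_ (le_max_right _ _)
    have : 0 < ‖z‖ := norm_pos_iff.2 hz0
    calc ‖canonicalTransform c r z‖ ^ 3 * ‖z‖ ^ 2
        = (‖canonicalTransform c r z‖ * ‖z‖) ^ 3 / ‖z‖ := by field_simp
      _ ≤ B ^ 3 / δ := by
        have hB0 : 0 ≤ B := (mul_nonneg (norm_nonneg _) (norm_nonneg _)).trans (hB z hz hz0)
        gcongr
        exact hB z hz hz0

lemma le_rpow_mul_rpow_of_pow_three_mul_sq_le {x y K : ℝ} (hx : 0 ≤ x) (hy : 0 < y)
    (h : x ^ 3 * y ^ 2 ≤ K) : x ≤ K ^ (1 / 3 : ℝ) * y ^ (-(2 / 3) : ℝ) := by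
  have hroot : (x ^ 3 * y ^ 2) ^ (1 / 3 : ℝ) = x * y ^ (2 / 3 : ℝ) := by
    rw [Real.mul_rpow (by positivity) (by positivity), ← Real.rpow_natCast, ← Real.rpow_natCast,
      ← Real.rpow_mul hx, ← Real.rpow_mul hy.le]
    norm_num
  rw [Real.rpow_neg hy.le, ← div_eq_mul_inv, le_div_iff₀ (by positivity), ← hroot]
  exact Real.rpow_le_rpow (by positivity) h (by norm_num)

lemma exists_hasPowerDecay_canonicalTransform (hr : ∀ i, 0 < r i) (hc : 0 < c) (hc1 : c ≤ 1) :
    ∃ C, HasPowerDecay (canonicalTransform c r) C (2 / 3) := by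
  obtain ⟨K, hK⟩ := exists_norm_canonicalTransform_pow_three_mul_le hr hc hc1
  exact ⟨K ^ (1 / 3 : ℝ), continuousOn_canonicalTransform hr hc,
    differentiableOn_canonicalTransform hr hc, fun z hz hz0 =>
      le_rpow_mul_rpow_of_pow_three_mul_sq_le (norm_nonneg _) (norm_pos_iff.2 hz0) (hK z hz hz0)⟩

end NearZero

section DensityAsymptotics

lemma tendsto_mul_I_of_tendsto_sq {α : Type*} {l : Filter α} {w : α → ℂ} {a : ℝ} (ha : 0 < a)
    (h : Tendsto (fun x => w x ^ 2) l (𝓝 (-(a ^ 2 : ℝ)))) (him : ∀ᶠ x in l, 0 ≤ (w x).im) :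
    Tendsto w l (𝓝 (a * Complex.I)) := by
  rw [tendsto_iff_norm_sub_tendsto_zero] at h ⊢
  have hscaled := h.const_mul a⁻¹
  rw [mul_zero] at hscaled
  refine squeeze_zero' (Eventually.of_forall fun _ => norm_nonneg _) ?_ hscaled
  filter_upwards [him] with x hx
  have hfactor : w x ^ 2 - (-(a ^ 2 : ℝ)) = (w x - a * Complex.I) * (w x + a * Complex.I) := by
    push_cast
    linear_combination ((a : ℂ) ^ 2) * Complex.I_sq
  have hle : a ≤ ‖w x + a * Complex.I‖ :=
    le_trans (by simpa using hx) (Complex.im_le_norm _)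
  rw [hfactor, norm_mul, inv_mul_eq_div, le_div_iff₀ ha]
  gcongr

lemma tendsto_of_tendsto_pow_three {α : Type*} {l : Filter α} {w : α → ℂ} {b : ℝ} (hb : 0 < b)
    (h : Tendsto (fun x => w x ^ 3) l (𝓝 (b ^ 3 : ℝ))) (him : ∀ᶠ x in l, 0 ≤ (w x).im)
    (hre : ∀ᶠ x in l, (w x).re ≤ 0) :
    Tendsto w l (𝓝 (b * (-(1 / 2) + (√3 / 2 : ℝ) * Complex.I))) := by
  rw [tendsto_iff_norm_sub_tendsto_zero] at h ⊢
  have hscaled := h.const_mul (2 / b ^ 2)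
  rw [mul_zero] at hscaled
  refine squeeze_zero' (Eventually.of_forall fun _ => norm_nonneg _) ?_ hscaled
  filter_upwards [him, hre] with x hx hx'
  set ω : ℂ := -(1 / 2) + (√3 / 2 : ℝ) * Complex.I with hω
  set ω' : ℂ := -(1 / 2) - (√3 / 2 : ℝ) * Complex.I with hω'
  have hsqrt : ((√3 : ℝ) : ℂ) ^ 2 = 3 := by exact_mod_cast Real.sq_sqrt zero_le_three
  have hfactor : w x ^ 3 - (b ^ 3 : ℝ) = (w x - b * ω) * ((w x - b) * (w x - b * ω')) := by
    rw [hω, hω']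
    push_cast
    linear_combination ((w x - b) * b ^ 2 * (√3 : ℂ) ^ 2 / 4) * Complex.I_sq
      - ((w x - b) * b ^ 2 / 4) * hsqrt
  have hreal : b ≤ ‖w x - b‖ := by
    refine le_trans ?_ (Complex.abs_re_le_norm _)
    rw [Complex.sub_re, Complex.ofReal_re, abs_of_nonpos (by linarith)]
    linarith
  have hlower : b / 2 ≤ ‖w x - b * ω'‖ := by
    refine le_trans ?_ (Complex.im_le_norm _)
    have hone : 1 ≤ √3 := Real.one_le_sqrt.2 (by norm_num)
    have him' : (w x - b * ω').im = (w x).im + b * (√3 / 2) := by simp [hω']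
    rw [him']
    nlinarith
  rw [hfactor, norm_mul, div_mul_eq_mul_div, le_div_iff₀ (by positivity), norm_mul]
  calc ‖w x - b * ω‖ * b ^ 2 = 2 * (‖w x - b * ω‖ * (b * (b / 2))) := by ring
    _ ≤ 2 * (‖w x - b * ω‖ * (‖w x - b‖ * ‖w x - b * ω'‖)) := by gcongr

lemma isEquivalent_const_mul_one_div_of_tendsto_mul {α : Type*} {l : Filter α} {g s : α → ℝ}
    {L : ℝ} (hL : L ≠ 0) (hs : ∀ᶠ x in l, s x ≠ 0)
    (h : Tendsto (fun x => s x * g x) l (𝓝 L)) :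
    Asymptotics.IsEquivalent l g fun x => L * (1 / s x) := by
  refine Asymptotics.isEquivalent_of_tendsto_one ?_
  have hdiv := h.div_const L
  rw [div_self hL] at hdiv
  refine hdiv.congr' ?_
  filter_upwards [hs] with x hx
  simp only [Pi.div_apply]
  field_simp

lemma tendsto_atTop_of_tendsto_mul {α : Type*} {l : Filter α} {g s : α → ℝ}
    {L : ℝ} (hL : 0 < L) (hs : Tendsto s l (𝓝[>] 0))
    (h : Tendsto (fun x => s x * g x) l (𝓝 L)) : Tendsto g l atTop := by
  refine (h.pos_mul_atTop hL hs.inv_tendsto_nhdsGT_zero).congr' ?_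
  filter_upwards [hs.eventually self_mem_nhdsWithin] with x hx
  rw [Pi.inv_apply, mul_comm, inv_mul_cancel_left₀ (ne_of_gt hx)]

lemma tendsto_rpow_nhdsGT_zero {s : ℝ} (hs : 0 < s) :
    Tendsto (fun x : ℝ => x ^ s) (𝓝[>] 0) (𝓝[>] 0) := by
  refine tendsto_nhdsWithin_iff.2 ⟨?_, ?_⟩
  · have h := (Real.continuousAt_rpow_const 0 s (Or.inr hs.le)).tendsto
    rw [Real.zero_rpow hs.ne'] at h
    exact h.mono_left nhdsWithin_le_nhds
  · filter_upwards [self_mem_nhdsWithin] with x hx using Real.rpow_pos_of_pos hx s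

lemma tendsto_ofReal_nhdsGT_zero :
    Tendsto (fun x : ℝ => (x : ℂ)) (𝓝[>] 0) (𝓝[closedUpperHalfPlaneSet \ {0}] 0) := by
  refine tendsto_nhdsWithin_iff.2 ⟨?_, ?_⟩
  · exact (Complex.continuous_ofReal.tendsto' 0 0 Complex.ofReal_zero).mono_left nhdsWithin_le_nhds
  · filter_upwards [self_mem_nhdsWithin] with x hx
    exact ⟨(Complex.ofReal_im x).ge, Complex.ofReal_ne_zero.2 (ne_of_gt hx)⟩

lemma tendsto_mul_boundaryDensity_of_tendsto_mul {m : ℂ → ℂ} {s : ℝ → ℝ} {l : Filter ℝ} {a : ℂ}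
    (h : Tendsto (fun x : ℝ => (s x : ℂ) * m x) l (𝓝 a)) :
    Tendsto (fun x => s x * boundaryDensity m x) l (𝓝 (a.im / Real.pi)) := by
  refine (((Complex.continuous_im.tendsto a).comp h).div_const Real.pi).congr fun x => ?_
  rw [Function.comp_apply, Complex.im_ofReal_mul, boundaryDensity, mul_div_assoc]

variable {ι : Type*} [Fintype ι] [Nonempty ι] {r : ι → ℝ} {c : ℝ}

lemma tendsto_sqrt_mul_boundaryDensity (hr : ∀ i, 0 < r i) (hc : 0 < c) (hc1 : c < 1) :
    Tendsto (fun x => √x * boundaryDensity (canonicalTransform c r) x) (𝓝[>] 0)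
      (𝓝 ((1 / Real.pi) * (1 / √(c * (1 - c))) * invMean r)) := by
  have hpos : 0 < c * (1 - c) := mul_pos hc (by linarith)
  have hi := invMean_pos hr
  have hlim : Tendsto (fun x : ℝ => ((√x : ℝ) : ℂ) * canonicalTransform c r x) (𝓝[>] 0)
      (𝓝 ((invMean r / √(c * (1 - c)) : ℝ) * Complex.I)) := by
    refine tendsto_mul_I_of_tendsto_sq (by positivity) ?_ ?_
    · rw [div_pow, Real.sq_sqrt hpos.le]
      refine ((tendsto_canonicalTransform_sq_mul hr hc hc1).comp
        tendsto_ofReal_nhdsGT_zero).congr' ?_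
      filter_upwards [self_mem_nhdsWithin] with x hx
      rw [mul_pow, ← Complex.ofReal_pow, Real.sq_sqrt (le_of_lt hx), mul_comm, Function.comp_apply]
    · filter_upwards [self_mem_nhdsWithin] with x hx
      rw [Complex.im_ofReal_mul]
      exact mul_nonneg (Real.sqrt_nonneg x) (im_canonicalTransform_ofReal_nonneg hr hc hx)
  convert tendsto_mul_boundaryDensity_of_tendsto_mul hlim using 2
  rw [Complex.im_ofReal_mul, Complex.I_im]
  ring

lemma re_canonicalTransform_one_ofReal_nonpos (hr : ∀ i, 0 < r i) {x : ℝ} (hx : 0 < x) :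
    (canonicalTransform 1 r x).re ≤ 0 := by
  have hnorm := norm_ratioMean_canonicalInvExt_le (z := x) hr one_pos (by simp)
  rw [inv_one, Real.sqrt_one] at hnorm
  rw [canonicalTransform, Complex.div_ofReal_re, Complex.sub_re, Complex.one_re]
  exact div_nonpos_of_nonpos_of_nonneg (sub_nonpos.2 ((Complex.re_le_norm _).trans hnorm)) hx.le

lemma tendsto_rpow_mul_boundaryDensity (hr : ∀ i, 0 < r i) :
    Tendsto (fun x => x ^ (2 / 3 : ℝ) * boundaryDensity (canonicalTransform 1 r) x) (𝓝[>] 0)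
      (𝓝 ((1 / Real.pi) * (√3 / 2) * invMean r ^ (2 / 3 : ℝ))) := by
  have hi := invMean_pos hr
  have hcube : ∀ {y : ℝ}, 0 < y → (y ^ (2 / 3 : ℝ)) ^ 3 = y ^ 2 := fun hy => by
    rw [← Real.rpow_mul_natCast hy.le, ← Real.rpow_natCast]
    norm_num
  have hlim : Tendsto (fun x : ℝ => ((x ^ (2 / 3 : ℝ) : ℝ) : ℂ) * canonicalTransform 1 r x)
      (𝓝[>] 0)
      (𝓝 ((invMean r ^ (2 / 3 : ℝ) : ℝ) * (-(1 / 2) + (√3 / 2 : ℝ) * Complex.I))) := by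
    refine tendsto_of_tendsto_pow_three (by positivity) ?_ ?_ ?_
    · rw [hcube hi]
      refine ((tendsto_canonicalTransform_one_pow_three_mul hr).comp
        tendsto_ofReal_nhdsGT_zero).congr' ?_
      filter_upwards [self_mem_nhdsWithin] with x hx
      rw [mul_pow, ← Complex.ofReal_pow, hcube hx, Complex.ofReal_pow, mul_comm,
        Function.comp_apply]
    · filter_upwards [self_mem_nhdsWithin] with x hx
      rw [Complex.im_ofReal_mul]
      exact mul_nonneg (Real.rpow_nonneg (le_of_lt hx) _)
        (im_canonicalTransform_ofReal_nonneg hr one_pos hx)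
    · filter_upwards [self_mem_nhdsWithin] with x hx
      rw [Complex.re_ofReal_mul]
      exact mul_nonpos_of_nonneg_of_nonpos (Real.rpow_nonneg (le_of_lt hx) _)
        (re_canonicalTransform_one_ofReal_nonpos hr hx)
  convert tendsto_mul_boundaryDensity_of_tendsto_mul hlim using 2
  rw [Complex.im_ofReal_mul, Complex.add_im, Complex.im_ofReal_mul, Complex.I_im]
  simp only [one_div, Complex.neg_im, Complex.inv_im, Complex.im_ofNat, neg_zero,
    Complex.normSq_ofNat, zero_div, mul_one, zero_add]
  ring

lemma boundaryDensity_isEquivalent_of_lt_one (hr : ∀ i, 0 < r i) (hc : 0 < c) (hc1 : c < 1) :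
    Asymptotics.IsEquivalent (𝓝[>] 0) (boundaryDensity (canonicalTransform c r)) fun x =>
      (1 / Real.pi) * (1 / √(c * (1 - c))) * invMean r * (1 / √x) := by
  have : 0 < 1 - c := sub_pos.2 hc1
  have hi := invMean_pos hr
  refine isEquivalent_const_mul_one_div_of_tendsto_mul (by positivity) ?_
    (tendsto_sqrt_mul_boundaryDensity hr hc hc1)
  filter_upwards [self_mem_nhdsWithin] with x hx using (Real.sqrt_pos.2 hx).ne'

lemma boundaryDensity_isEquivalent_one (hr : ∀ i, 0 < r i) :
    Asymptotics.IsEquivalent (𝓝[>] 0) (boundaryDensity (canonicalTransform 1 r)) fun x =>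
      (1 / Real.pi) * (√3 / 2) * invMean r ^ (2 / 3 : ℝ) * (1 / x ^ (2 / 3 : ℝ)) := by
  have hi := invMean_pos hr
  refine isEquivalent_const_mul_one_div_of_tendsto_mul (by positivity) ?_
    (tendsto_rpow_mul_boundaryDensity hr)
  filter_upwards [self_mem_nhdsWithin] with x hx using (Real.rpow_pos_of_pos hx _).ne'

lemma tendsto_boundaryDensity_atTop (hr : ∀ i, 0 < r i) (hc : 0 < c) (hc1 : c ≤ 1) :
    Tendsto (boundaryDensity (canonicalTransform c r)) (𝓝[>] 0) atTop := by
  have hi := invMean_pos hr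
  rcases hc1.lt_or_eq with hlt | rfl
  · have : 0 < 1 - c := sub_pos.2 hlt
    refine tendsto_atTop_of_tendsto_mul (by positivity) ?_
      (tendsto_sqrt_mul_boundaryDensity hr hc hlt)
    exact (tendsto_rpow_nhdsGT_zero one_half_pos).congr fun x => (Real.sqrt_eq_rpow x).symm
  · exact tendsto_atTop_of_tendsto_mul (by positivity)
      (tendsto_rpow_nhdsGT_zero (by norm_num)) (tendsto_rpow_mul_boundaryDensity hr)

end DensityAsymptotics

section Matrix

variable {n : Type*} [Fintype n] [DecidableEq n] {R : Matrix n n ℂ} {a b : ℂ}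

open Unitary in
lemma trace_conjStarAlgAut (U : unitary (Matrix n n ℂ)) (X : Matrix n n ℂ) :
    (conjStarAlgAut ℂ _ U X).trace = X.trace := by
  rw [conjStarAlgAut_apply, Matrix.trace_mul_comm, ← mul_assoc, coe_star_mul_self, one_mul]

open Unitary in
lemma inv_smul_one_sub_smul_eq (hR : R.IsHermitian) (h : ∀ i, a - b * hR.eigenvalues i ≠ 0) :
    (a • (1 : Matrix n n ℂ) - b • R)⁻¹ = conjStarAlgAut ℂ _ hR.eigenvectorUnitary
      (Matrix.diagonal fun i => (a - b * hR.eigenvalues i)⁻¹) := by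
  have hdiag : (Matrix.diagonal fun i => a - b * (hR.eigenvalues i : ℂ))
      = a • (1 : Matrix n n ℂ) - b • Matrix.diagonal (RCLike.ofReal ∘ hR.eigenvalues) := by
    rw [Matrix.smul_one_eq_diagonal, ← Matrix.diagonal_smul, Matrix.diagonal_sub]
    rfl
  have hspec : a • (1 : Matrix n n ℂ) - b • R = conjStarAlgAut ℂ _ hR.eigenvectorUnitary
      (Matrix.diagonal fun i => a - b * hR.eigenvalues i) := by
    rw [hdiag, map_sub, map_smul, map_smul, map_one, ← hR.spectral_theorem]
  refine Matrix.inv_eq_right_inv ?_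
  rw [hspec, ← map_mul, Matrix.diagonal_mul_diagonal]
  simp only [mul_inv_cancel₀ (h _), Matrix.diagonal_one, map_one]

lemma trace_inv_smul_one_sub_smul (hR : R.IsHermitian)
    (h : ∀ i, a - b * hR.eigenvalues i ≠ 0) :
    (a • (1 : Matrix n n ℂ) - b • R)⁻¹.trace = ∑ i, (a - b * hR.eigenvalues i)⁻¹ := by
  rw [inv_smul_one_sub_smul_eq hR h, trace_conjStarAlgAut, Matrix.trace_diagonal]

lemma trace_mul_inv_smul_one_sub_smul (hR : R.IsHermitian)
    (h : ∀ i, a - b * hR.eigenvalues i ≠ 0) :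
    (R * (a • (1 : Matrix n n ℂ) - b • R)⁻¹).trace
      = ∑ i, (hR.eigenvalues i : ℂ) / (a - b * hR.eigenvalues i) := by
  rw [inv_smul_one_sub_smul_eq hR h]
  nth_rw 1 [hR.spectral_theorem]
  rw [← map_mul, trace_conjStarAlgAut, Matrix.diagonal_mul_diagonal, Matrix.trace_diagonal]
  rfl

end Matrix

section CanonicalSolution

variable {M : ℕ} {c : ℝ} {z t κ p : ℂ} {R : Matrix (Fin M) (Fin M) ℂ}

lemma one_div_mul_sum_eq_expect {𝕜 : Type*} [Semifield 𝕜] [CharZero 𝕜] (f : Fin M → 𝕜) :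
    1 / (M : 𝕜) * ∑ i, f i = 𝔼 i, f i := by
  rw [Fintype.expect_eq_sum_div_card, Fintype.card_fin, one_div, inv_mul_eq_div]

lemma normalizedTraceInv_eq_invMean (hR : R.PosDef) :
    normalizedTraceInv R = invMean hR.1.eigenvalues := by
  have htrace := trace_inv_smul_one_sub_smul hR.1 (a := 0) (b := -1) fun i => by
    simpa using (hR.eigenvalues_pos i).ne'
  simp only [zero_smul, neg_smul, one_smul, sub_neg_eq_add, zero_add, neg_mul, one_mul] at htrace
  rw [normalizedTraceInv, htrace, invMean, ← one_div_mul_sum_eq_expect, Complex.re_sum]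
  simp only [← Complex.ofReal_inv, Complex.ofReal_re]

lemma neg_sub_neg_div_mul_eq (hp0 : p ≠ 0) (x : ℂ) : -z - -z / p * x = z * (x - p) / p := by
  field_simp
  ring

lemma inv_mul_div_one_sub_eq (hc : c ≠ 0) (hz : z ≠ 0) (ht : t ≠ 0) :
    (z * c * t / (1 - z * c ^ 2 * t ^ 2))⁻¹ = (c * (z * t))⁻¹ - c * t := by
  have hc' : (c : ℂ) ≠ 0 := Complex.ofReal_ne_zero.2 hc
  rw [inv_div]
  field_simp

lemma resolventMatrix_eq_inv (hκ : z * c * t / (1 - z * c ^ 2 * t ^ 2) = κ) :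
    resolventMatrix c R z t = ((-z) • (1 : Matrix (Fin M) (Fin M) ℂ) - κ • R)⁻¹ := by
  rw [resolventMatrix, hκ, neg_smul]

lemma trace_mul_resolventMatrix (hR : R.IsHermitian) (hz : z ≠ 0) (hp0 : p ≠ 0)
    (hp : ∀ i, (hR.eigenvalues i : ℂ) ≠ p)
    (hκ : z * c * t / (1 - z * c ^ 2 * t ^ 2) = -z / p) :
    1 / (M : ℂ) * (R * resolventMatrix c R z t).trace = transfer hR.eigenvalues p / z := by
  have hne i := sub_ne_zero.2 (hp i)
  rw [resolventMatrix_eq_inv hκ, trace_mul_inv_smul_one_sub_smul hR fun i => by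
      rw [neg_sub_neg_div_mul_eq hp0]
      exact div_ne_zero (mul_ne_zero hz (hne i)) hp0,
    one_div_mul_sum_eq_expect, transfer_eq_expect, Finset.expect_div]
  refine Finset.expect_congr rfl fun i _ => ?_
  rw [neg_sub_neg_div_mul_eq hp0]
  have := hne i
  field_simp

lemma trace_resolventMatrix (hR : R.IsHermitian) (hz : z ≠ 0) (hp0 : p ≠ 0)
    (hp : ∀ i, (hR.eigenvalues i : ℂ) ≠ p)
    (hκ : z * c * t / (1 - z * c ^ 2 * t ^ 2) = -z / p) :
    1 / (M : ℂ) * (resolventMatrix c R z t).trace = p * resolventMean hR.eigenvalues p / z := by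
  have hne i := sub_ne_zero.2 (hp i)
  rw [resolventMatrix_eq_inv hκ, trace_inv_smul_one_sub_smul hR fun i => by
      rw [neg_sub_neg_div_mul_eq hp0]
      exact div_ne_zero (mul_ne_zero hz (hne i)) hp0,
    one_div_mul_sum_eq_expect, resolventMean, Finset.mul_expect, Finset.expect_div]
  refine Finset.expect_congr rfl fun i _ => ?_
  rw [neg_sub_neg_div_mul_eq hp0]
  have := hne i
  field_simp

lemma coeff_eq_neg_div_of_canonicalMap_eq {ι : Type*} [Fintype ι] {r : ι → ℝ} (hc : c ≠ 0)
    (hz : z ≠ 0) (h : canonicalMap c r p = z) (ht : transfer r p / z = t) :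
    z * c * t / (1 - z * c ^ 2 * t ^ 2) = -z / p := by
  subst ht
  apply inv_injective
  rw [inv_mul_div_one_sub_eq hc hz (div_ne_zero (transfer_ne_zero hz h) hz),
    inv_neg_div_of_canonicalMap_eq hc hz h, mul_div_cancel₀ _ hz]

lemma canonicalMap_eq_of_coeff_eq {ι : Type*} [Fintype ι] {r : ι → ℝ} (hc : c ≠ 0) (hz : z ≠ 0)
    (ht0 : t ≠ 0) (hκ : z * c * t / (1 - z * c ^ 2 * t ^ 2) = -z / p)
    (ht : transfer r p / z = t) : canonicalMap c r p = z := by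
  have hc' : (c : ℂ) ≠ 0 := Complex.ofReal_ne_zero.2 hc
  have hinv := inv_mul_div_one_sub_eq hc hz ht0
  rw [hκ, inv_div, div_eq_iff (neg_ne_zero.2 hz)] at hinv
  rw [canonicalMap, (div_eq_iff hz).1 ht, hinv]
  field_simp
  ring

lemma im_coeff_pos (hc : 0 < c) (hz : z ≠ 0) (ht : 0 < t.im) (hzt : 0 < (z * t).im) :
    0 < (z * c * t / (1 - z * c ^ 2 * t ^ 2)).im := by
  have hinv := inv_mul_div_one_sub_eq hc.ne' hz (ne_zero_of_im_pos ht)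
  have him : (z * c * t / (1 - z * c ^ 2 * t ^ 2))⁻¹.im < 0 := by
    rw [hinv, Complex.sub_im, Complex.inv_im, Complex.im_ofReal_mul, Complex.im_ofReal_mul]
    have hnonneg := Complex.normSq_nonneg (c * (z * t))
    have hneg : -(c * (z * t).im) / Complex.normSq (c * (z * t)) ≤ 0 :=
      div_nonpos_of_nonpos_of_nonneg (neg_nonpos.2 (mul_pos hc hzt).le) hnonneg
    linarith [mul_pos hc ht]
  rw [Complex.inv_im] at him
  by_contra! hle
  exact him.not_ge (div_nonneg (neg_nonneg.2 hle) (Complex.normSq_nonneg _))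

lemma exists_mem_canonicalDomain_of_isCanonicalSolution (hR : R.PosDef) (hc : 0 < c)
    (hz : 0 < z.im) (h : IsCanonicalSolution c R z t) :
    ∃ p ∈ canonicalDomain c hR.1.eigenvalues, canonicalMap c hR.1.eigenvalues p = z ∧
      transfer hR.1.eigenvalues p / z = t := by
  obtain ⟨ht, hzt, heq⟩ := h
  have hz0 := ne_zero_of_im_pos hz
  have hκ_im := im_coeff_pos hc hz0 ht hzt
  obtain ⟨p, hp0, hκ⟩ : ∃ p, p ≠ 0 ∧ z * c * t / (1 - z * c ^ 2 * t ^ 2) = -z / p :=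
    ⟨-z / (z * c * t / (1 - z * c ^ 2 * t ^ 2)),
      div_ne_zero (neg_ne_zero.2 hz0) (ne_zero_of_im_pos hκ_im),
      (div_div_cancel₀ (neg_ne_zero.2 hz0)).symm⟩
  have hpi : ∀ i, (hR.1.eigenvalues i : ℂ) ≠ p := fun i hi => by
    have him : (-z - -z / p * (hR.1.eigenvalues i : ℂ)).im < 0 := by
      rw [← hκ, Complex.sub_im, Complex.neg_im, Complex.im_mul_ofReal]
      linarith [mul_pos hκ_im (hR.eigenvalues_pos i)]
    rw [neg_sub_neg_div_mul_eq hp0, hi, sub_self, mul_zero, zero_div] at him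
    exact him.ne rfl
  have htp : transfer hR.1.eigenvalues p / z = t := by
    rw [heq, trace_mul_resolventMatrix hR.1 hz0 hp0 hpi hκ]
  have hpz := canonicalMap_eq_of_coeff_eq hc.ne' hz0 (ne_zero_of_im_pos ht) hκ htp
  have hzt' : z * t = transfer hR.1.eigenvalues p := by rw [← htp, mul_div_cancel₀ _ hz0]
  exact ⟨p, mem_canonicalDomain_of_im_pos hc hz hpz (htp ▸ ht) (hzt' ▸ hzt.le), hpz, htp⟩

variable [NeZero M]

lemma isCanonicalSolution_of_mem_canonicalDomain (hR : R.PosDef) (hc : 0 < c)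
    (hp : p ∈ canonicalDomain c hR.1.eigenvalues) (hpz : canonicalMap c hR.1.eigenvalues p = z) :
    IsCanonicalSolution c R z (transfer hR.1.eigenvalues p / z) := by
  obtain ⟨hp_im, hz, hs⟩ := hp
  rw [hpz] at hz hs
  have hz0 := ne_zero_of_im_pos hz
  have hp0 := ne_zero_of_im_pos hp_im
  have hpi i := ofReal_ne_of_im_pos hp_im (hR.1.eigenvalues i)
  refine ⟨im_transfer_div_pos hR.eigenvalues_pos hpi hp0 hz hs.le, ?_, ?_⟩
  · rw [mul_div_cancel₀ _ hz0]
    exact im_transfer_pos hR.eigenvalues_pos hp_im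
  · exact (trace_mul_resolventMatrix hR.1 hz0 hp0 hpi
      (coeff_eq_neg_div_of_canonicalMap_eq hc.ne' hz0 hpz rfl)).symm

lemma isCanonicalSolution_iff (hR : R.PosDef) (hc : 0 < c) (hz : 0 < z.im) :
    IsCanonicalSolution c R z t ↔
      t = transfer hR.1.eigenvalues (canonicalInv c hR.1.eigenvalues z) / z := by
  have hr := hR.eigenvalues_pos
  constructor
  · intro h
    obtain ⟨p, hp, rfl, rfl⟩ := exists_mem_canonicalDomain_of_isCanonicalSolution hR hc hz h
    rw [canonicalInv_canonicalMap hr hc hp]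
  · rintro rfl
    exact isCanonicalSolution_of_mem_canonicalDomain hR hc (canonicalInv_mem hr hc hz)
      (canonicalMap_canonicalInv hr hc hz)

lemma existsUnique_isCanonicalSolution (hR : R.PosDef) (hc : 0 < c) (hz : 0 < z.im) :
    ∃! t, IsCanonicalSolution c R z t := by
  simp only [isCanonicalSolution_iff hR hc hz, existsUnique_eq]

lemma canonicalT_eq (hR : R.PosDef) (hc : 0 < c) (hz : 0 < z.im) :
    canonicalT c R z = transfer hR.1.eigenvalues (canonicalInv c hR.1.eigenvalues z) / z :=
  (isCanonicalSolution_iff hR hc hz).1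
    (Classical.epsilon_spec (existsUnique_isCanonicalSolution hR hc hz).exists)

lemma trace_matrixT (hR : R.PosDef) (hc : 0 < c) (hz : 0 < z.im) :
    1 / (M : ℂ) * (matrixT c R z).trace = canonicalTransform c hR.1.eigenvalues z := by
  have hr := hR.eigenvalues_pos
  have hz0 := ne_zero_of_im_pos hz
  have hp := canonicalInv_mem hr hc hz
  rw [matrixT, canonicalTransform_eq hr hc hz.le, canonicalInvExt_eq hr hc hz]
  exact trace_resolventMatrix hR.1 hz0 (ne_zero_of_im_pos hp.1) (ne_of_mem_canonicalDomain hp)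
    (coeff_eq_neg_div_of_canonicalMap_eq hc.ne' hz0 (canonicalMap_canonicalInv hr hc hz)
      (canonicalT_eq hR hc hz).symm)

end CanonicalSolution

section DeterministicEquivalent

variable {M : ℕ} {c : ℝ} {R : Matrix (Fin M) (Fin M) ℂ}

lemma hasCanonicalStieltjes_unique {μ ν : Measure ℝ} (hμ : HasCanonicalStieltjes c R μ)
    (hν : HasCanonicalStieltjes c R ν) : μ = ν := by
  have := hμ.finite
  have := hν.finite
  exact eq_of_integral_inv_ofReal_sub_eq fun z hz =>
    (hμ.stieltjes z hz).trans (hν.stieltjes z hz).symm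

lemma isProbabilityMeasure_boundaryMeasure_canonicalTransform {ι : Type*} [Fintype ι] [Nonempty ι]
    {r : ι → ℝ} (hr : ∀ i, 0 < r i) (hc : 0 < c) (hc1 : c ≤ 1) :
    IsProbabilityMeasure (boundaryMeasure (canonicalTransform c r)) := by
  obtain ⟨C, hm⟩ := exists_hasPowerDecay_canonicalTransform hr hc hc1
  exact hm.isProbabilityMeasure_boundaryMeasure (by norm_num) (by norm_num)
    (fun _ => im_canonicalTransform_ofReal_of_neg hr hc)
    (fun _ => im_canonicalTransform_ofReal_nonneg hr hc) (tendsto_neg_mul_canonicalTransform hr hc)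

lemma isContinuousDensity_boundaryDensity_canonicalTransform {ι : Type*} [Fintype ι] [Nonempty ι]
    {r : ι → ℝ} (hr : ∀ i, 0 < r i) (hc : 0 < c) (hc1 : c ≤ 1) :
    IsContinuousDensity (boundaryMeasure (canonicalTransform c r))
      (boundaryDensity (canonicalTransform c r)) := by
  obtain ⟨C, hm⟩ := exists_hasPowerDecay_canonicalTransform hr hc hc1
  exact ⟨hm.continuousOn_boundaryDensity, fun x hx =>
    div_nonneg (im_canonicalTransform_ofReal_nonneg hr hc hx) Real.pi_pos.le, rfl⟩

variable [NeZero M]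

lemma hasCanonicalStieltjes_boundaryMeasure (hR : R.PosDef) (hc : 0 < c) (hc1 : c ≤ 1) :
    HasCanonicalStieltjes c R (boundaryMeasure (canonicalTransform c hR.1.eigenvalues)) := by
  have hr := hR.eigenvalues_pos
  have := isProbabilityMeasure_boundaryMeasure_canonicalTransform hr hc hc1
  obtain ⟨C, hm⟩ := exists_hasPowerDecay_canonicalTransform hr hc hc1
  refine ⟨inferInstance, boundaryMeasure_Iio_zero _, fun z hz => ?_⟩
  rw [trace_matrixT hR hc hz]
  exact hm.integral_inv_sub_boundaryMeasure (by norm_num) (by norm_num)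
    (fun _ => im_canonicalTransform_ofReal_of_neg hr hc)
    (fun _ => im_canonicalTransform_ofReal_nonneg hr hc) hz

lemma deterministicEquivalent_eq (hR : R.PosDef) (hc : 0 < c) (hc1 : c ≤ 1) :
    deterministicEquivalent c R = boundaryMeasure (canonicalTransform c hR.1.eigenvalues) := by
  have h := hasCanonicalStieltjes_boundaryMeasure hR hc hc1
  exact hasCanonicalStieltjes_unique (Classical.epsilon_spec ⟨_, h⟩) h

end DeterministicEquivalent

end CanonicalEquation

end

open CanonicalEquation in
theorem mainTheorem11_general (M : ℕ) (hM : 0 < M) (R : Matrix (Fin M) (Fin M) ℂ) (hR : R.PosDef)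
    (c : ℝ) (hc : 0 < c) (hc1 : c ≤ 1) :
    (∀ z : ℂ, 0 < z.im → ∃! t : ℂ, IsCanonicalSolution c R z t) ∧
    (∃! ν : Measure ℝ, HasCanonicalStieltjes c R ν) ∧
    HasCanonicalStieltjes c R (deterministicEquivalent c R) ∧
    IsProbabilityMeasure (deterministicEquivalent c R) ∧
    ∃ g : ℝ → ℝ, IsContinuousDensity (deterministicEquivalent c R) g ∧
      Tendsto g (𝓝[>] 0) atTop ∧
      (c < 1 → Asymptotics.IsEquivalent (𝓝[>] 0) g (fun x : ℝ =>
        (1 / Real.pi) * (1 / Real.sqrt (c * (1 - c))) * normalizedTraceInv R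
          * (1 / Real.sqrt x))) ∧
      (c = 1 → Asymptotics.IsEquivalent (𝓝[>] 0) g (fun x : ℝ =>
        (1 / Real.pi) * (Real.sqrt 3 / 2) * normalizedTraceInv R ^ (2 / 3 : ℝ)
          * (1 / x ^ (2 / 3 : ℝ)))) := by
  have : NeZero M := ⟨hM.ne'⟩
  have hr := hR.eigenvalues_pos
  have hν := hasCanonicalStieltjes_boundaryMeasure hR hc hc1
  rw [deterministicEquivalent_eq hR hc hc1, normalizedTraceInv_eq_invMean hR]
  refine ⟨fun z hz => existsUnique_isCanonicalSolution hR hc hz,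
    ⟨_, hν, fun ν h => hasCanonicalStieltjes_unique h hν⟩, hν,
    isProbabilityMeasure_boundaryMeasure_canonicalTransform hr hc hc1, _,
    isContinuousDensity_boundaryDensity_canonicalTransform hr hc hc1,
    tendsto_boundaryDensity_atTop hr hc hc1,
    fun hlt => boundaryDensity_isEquivalent_of_lt_one hr hc hlt, ?_⟩
  rintro rfl
  exact boundaryDensity_isEquivalent_one hr

theorem mainTheorem11 (M L N : ℕ) (hM : 0 < M) (hL : 0 < L) (hN : 0 < N)
    (R : Matrix (Fin M) (Fin M) ℂ) (hR : R.PosDef)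
    (c : ℝ) (hc : c = (M : ℝ) * (L : ℝ) / (N : ℝ)) (hc1 : c ≤ 1) :
    (∀ z : ℂ, 0 < z.im → ∃! t : ℂ, IsCanonicalSolution c R z t) ∧
    (∃! ν : Measure ℝ, HasCanonicalStieltjes c R ν) ∧
    HasCanonicalStieltjes c R (deterministicEquivalent c R) ∧
    IsProbabilityMeasure (deterministicEquivalent c R) ∧
    ∃ g : ℝ → ℝ, IsContinuousDensity (deterministicEquivalent c R) g ∧
      Tendsto g (𝓝[>] 0) atTop ∧
      (c < 1 → Asymptotics.IsEquivalent (𝓝[>] 0) g (fun x : ℝ =>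
        (1 / Real.pi) * (1 / Real.sqrt (c * (1 - c))) * normalizedTraceInv R
          * (1 / Real.sqrt x))) ∧
      (c = 1 → Asymptotics.IsEquivalent (𝓝[>] 0) g (fun x : ℝ =>
        (1 / Real.pi) * (Real.sqrt 3 / 2) * normalizedTraceInv R ^ (2 / 3 : ℝ)
          * (1 / x ^ (2 / 3 : ℝ)))) :=
  mainTheorem11_general M hM R hR c (by rw [hc]; positivity) hc1
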